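/- **Theorem (correctness of the dotted-triple-graph verification protocol).** *Graphs.* For a finite graph $G$, the dotted graph $D(G)$ is obtained by replacing every edge of $G$ with a new ("added") vertex joined to the two endpoints of the edge; the old vertices are "primary". The triple-graph $T(G)$ has three copies of every vertex of $G$, every copy of $v$ being joined to every copy of $w$ when $vw\in E(G)$; put $DT(G)=D(T(G))$. Each vertex of $DT(G)$ has a base-location in $D(G)$. A trap-colouring of $DT(G)$ colours the three primary vertices over each $v\in V(G)$ white, black, green, each colour once; an added vertex gets the colour of its two neighbours if these agree, and red otherwise. The set $D$ of dummies consists of all red vertices, the white added and the black primary vertices; the traps are the white primary and the black added vertices. *Computation.* Let $\mathbb M$ be a measurement pattern on the graph state of $D(G)$: input set $I$ and output set $O$ of vertices of $D(G)$, default angles $\phi_i\in A=\{0,\pi/4,\dots,7\pi/4\}$, an order of measurement of the non-output qubits, for each qubit the sets of earlier measured qubits on whose outcome parities $s^X_i,s^Z_i$ its $X$- and $Z$-corrections depend (the measured angle is $\phi_i'=(-1)^{s^X_i}\phi_i+s^Z_i\pi$, and output qubits are corrected by $Z^{s^Z_i}X^{s^X_i}$), and a classical result computed from the measurement outcomes.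 Non-input qubits start in $|+\rangle$. Assume that $\mathbb M$ performs a computation $\mathcal E=(\mathcal E_a)_a$, that is, for every unit input vector $|\mathcal I\rangle$ and every classical result $a$, the unnormalised state of the corrected output qubits, summed over all branches with classical result $a$, is $\mathcal E_a(|\mathcal I\rangle\langle\mathcal I|)$. (Purely quantum output: only one $a$. Purely classical output: $O=\emptyset$.) *Protocol.* The verifier chooses a trap-colouring, angles $\theta_i\in A$ and bits $r_i$ for all vertices $i$ of $DT(G)$, bits $d_i$ for the dummies, bits $x_i$ for the inputs, and an order of measurement that follows the order of $\mathbb M$ on base-locations and is arbitrary among vertices with the same base-location. The computation is located on the green vertices. The verifier sends $\bigotimes_i X^{x_i}Z(\theta_i)|\mathcal I\rangle$ on the green input qubits, where $Z(\theta)=\mathrm{diag}(1,e^{i\theta})$, and, on the remaining qubits, $|d_i\rangle$ for $i\in D$ and $\prod_{j\in N(i)\cap D}Z^{d_j}|+_{\theta_i}\rangle$ for $i\notin D$, where $N$ denotes neighbourhoods in $DT(G)$. The prover applies a controlled-$Z$ along every edge of $DT(G)$ and then, for each qubit $i$ whose base-location is not in $O$, measures it in the basis $(|0\rangle\pm e^{i\delta_i}|1\rangle)/\sqrt2$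 and reports $b_i$; the verifier records $s_i=b_i+r_i$. Put $x_i=0$ for every $i$ that is not a green input, and, for green $i$, $$\kappa_i=\theta_i+\pi\sum_{k\in N(i)}x_k+[\,i\text{ is an input}\,]\;\pi\sum_{j\in N(i)\cap D}d_j .$$ The angles sent are $\delta_i=(-1)^{x_i}(\phi_i'+\kappa_i)+r_i\pi$ at green qubits, with $\phi'_i$ the angle of $\mathbb M$ computed from the recorded $s$, and $\delta_i=\theta_i+r_i\pi$ at traps and dummies. The unmeasured qubits are returned; the verifier measures the traps among them with angle $\theta_t+r_t\pi$, obtaining $b_t$, applies $X^{x_i}$, then $Z(-\kappa_i)$, and then the corrections of $\mathbb M$ to the green output qubits, and accepts if $b_t=r_t$ for all traps $t$. *Claim.* Suppose that verifier and prover follow the protocol. Then, for every choice of the verifier's secrets (hence also on average over any distribution of them) and every unit input vector $|\mathcal I\rangle$: 1. The green vertices induce a copy of $D(G)$ in $DT(G)$, with matching base-locations. Every vertex is exactly one of: green, a trap, a dummy. There is exactly one trap at every base-location, and no trap is adjacent to a vertex that is not a dummy. Correspondingly, up to a global phase, the state after the prover's entangling step is the tensor product of the graph state on the green $D(G)$ carrying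 the input, with $Z(\theta_i)$ applied to every qubit $i$ and then $\prod_{j\in N(i)\cap D}Z^{d_j}\,X^{x_i}$ to every input qubit $i$ before entangling, of $|+_{\theta_t}\rangle$ at every trap $t$, and of $|d_i\rangle$ at every dummy $i$. 2. In every branch of non-zero probability, $b_t=r_t$ for all traps $t$; the verifier accepts with probability $1$. 3. The output is correct: for every classical result $a$, the unnormalised state of the decoded output qubits, summed over all branches with classical result $a$, is $\mathcal E_a(|\mathcal I\rangle\langle\mathcal I|)$. -/

import Mathlib

open scoped ComplexConjugate

noncomputable section

/-! ## Dotted graphs, triple graphs, trap-colourings -/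

section Graphs

variable {V : Type*}

/-- Vertices of `D(G)`: primary vertices (those of `G`) and added vertices (the edges of `G`). -/
abbrev DottedVertex (G : SimpleGraph V) : Type _ := V ⊕ G.edgeSet

/-- Adjacency in `D(G)`: an added vertex is joined to the two endpoints of its edge. -/
def DottedAdj (G : SimpleGraph V) : DottedVertex G → DottedVertex G → Prop
  | .inl v, .inr e => v ∈ e.1
  | .inr e, .inl v => v ∈ e.1
  | _, _ => False

/-- The dotted graph `D(G)`. -/
def dotted (G : SimpleGraph V) : SimpleGraph (DottedVertex G) where
  Adj := DottedAdj G
  symm := ⟨by rintro (v | e) (w | f) h <;> exact h⟩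
  loopless := ⟨by rintro (v | e) h <;> exact h⟩

instance (G : SimpleGraph V) [DecidableEq V] : DecidableRel (dotted G).Adj := fun a b =>
  match a, b with
  | .inl _, .inl _ => isFalse id
  | .inr _, .inr _ => isFalse id
  | .inl v, .inr e => inferInstanceAs (Decidable (v ∈ e.1))
  | .inr e, .inl v => inferInstanceAs (Decidable (v ∈ e.1))

/-- The triple-graph `T(G)`: three copies `(v, k)` of each vertex, and all nine edges between the
copies of `v` and of `w` whenever `v` and `w` are adjacent. -/
def tripleGraph (G : SimpleGraph V) : SimpleGraph (V × Fin 3) where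
  Adj p q := G.Adj p.1 q.1
  symm := ⟨fun _ _ h => h.symm⟩
  loopless := ⟨fun _ h => h.ne rfl⟩

instance (G : SimpleGraph V) [DecidableRel G.Adj] : DecidableRel (tripleGraph G).Adj :=
  fun p q => inferInstanceAs (Decidable (G.Adj p.1 q.1))

/-- Vertices of the dotted triple-graph `DT(G) = D(T(G))`. -/
abbrev DTVertex (G : SimpleGraph V) : Type _ := DottedVertex (tripleGraph G)

/-- The dotted triple-graph. -/
abbrev dottedTriple (G : SimpleGraph V) : SimpleGraph (DTVertex G) := dotted (tripleGraph G)

/-- The projection `T(G) → G`. -/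
def tripleProj (G : SimpleGraph V) : tripleGraph G →g G where
  toFun := Prod.fst
  map_rel' h := h

/-- The base-location, in `D(G)`, of a vertex of `DT(G)`. -/
def baseLocation (G : SimpleGraph V) : DTVertex G → DottedVertex G
  | .inl p => .inl p.1
  | .inr e => .inr ((tripleProj G).mapEdgeSet e)

/-- The four colours. -/
inductive Colour
  | white | black | green | red
  deriving DecidableEq

/-- Trap-colourings of `DT(G)`. -/
structure TrapColouring (G : SimpleGraph V) where
  colour : DTVertex G → Colour
  primary_ne_red : ∀ p, colour (.inl p) ≠ .red
  primary_unique : ∀ v c, c ≠ .red → ∃! k, colour (.inl (v, k)) = c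
  added_same : ∀ (e : (tripleGraph G).edgeSet) c,
    (∀ p ∈ e.1, colour (.inl p) = c) → colour (.inr e) = c
  added_diff : ∀ (e : (tripleGraph G).edgeSet), ∀ p ∈ e.1, ∀ q ∈ e.1,
    colour (.inl p) ≠ colour (.inl q) → colour (.inr e) = .red

namespace TrapColouring

variable {G : SimpleGraph V} (κ : TrapColouring G)

/-- The positions of the dummies: all red vertices, the white added and the black primary ones. -/
def IsDummy : DTVertex G → Prop
  | .inl p => κ.colour (.inl p) = .black
  | .inr e => κ.colour (.inr e) = .red ∨ κ.colour (.inr e) = .white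

/-- The positions of the traps: the white primary and the black added vertices. -/
def IsTrap : DTVertex G → Prop
  | .inl p => κ.colour (.inl p) = .white
  | .inr e => κ.colour (.inr e) = .black

instance : DecidablePred κ.IsDummy := fun w =>
  match w with
  | .inl p => inferInstanceAs (Decidable (κ.colour (.inl p) = .black))
  | .inr e => inferInstanceAs
      (Decidable (κ.colour (.inr e) = .red ∨ κ.colour (.inr e) = .white))

instance : DecidablePred κ.IsTrap := fun w =>
  match w with
  | .inl p => inferInstanceAs (Decidable (κ.colour (.inl p) = .white))
  | .inr e => inferInstanceAs (Decidable (κ.colour (.inr e) = .black))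

/-- The green copy of `G` inside `T(G)`. -/
def greenHom : G →g tripleGraph G where
  toFun v := (v, (κ.primary_unique v .green (by decide)).choose)
  map_rel' h := h

/-- The vertex of the green copy of `D(G)` at a given base-location. -/
def greenVertex : DottedVertex G → DTVertex G
  | .inl v => .inl (κ.greenHom v)
  | .inr e => .inr (κ.greenHom.mapEdgeSet e)

end TrapColouring

end Graphs

/-! ## Qubit registers

A (not necessarily normalised) pure state of qubits labelled by `W` is its vector of amplitudes in
the computational basis.  The angle `k π / 4` is encoded by `k : ZMod 8`, so `π` is `4`. -/

section Registers

/-- State vectors of qubits labelled by `W`. -/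
abbrev QState (W : Type*) : Type _ := (W → ZMod 2) → ℂ

/-- `e ^ (i k π / 4)`. -/
def phase (k : ZMod 8) : ℂ := Complex.exp ((k.val : ℂ) * (Real.pi / 4) * Complex.I)

/-- The angle `b π`. -/
def bitPi (b : ZMod 2) : ZMod 8 := if b = 0 then 0 else 4

/-- The angle `(-1) ^ b k`. -/
def bitNeg (b : ZMod 2) (k : ZMod 8) : ZMod 8 := if b = 0 then k else -k

/-- The single-qubit state `(|0⟩ + e ^ (i θ) |1⟩) / √2`. -/
def plusKet (θ : ZMod 8) (z : ZMod 2) : ℂ := (if z = 0 then 1 else phase θ) / (√2 : ℝ)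

variable {W : Type*} [Fintype W] [DecidableEq W]

/-- The squared norm of a state vector. -/
def weight (Ψ : QState W) : ℝ := ∑ z, ‖Ψ z‖ ^ 2

/-- The projector `|Ψ⟩⟨Ψ|`. -/
def ketBra (Ψ : QState W) : Matrix (W → ZMod 2) (W → ZMod 2) ℂ := fun z z' => Ψ z * conj (Ψ z')

/-- `⨂ w, Z(θ w)`, with `Z(θ) = diag(1, e ^ (i θ))`. -/
def rotZ (θ : W → ZMod 8) (Ψ : QState W) : QState W := fun z =>
  (∏ w, if z w = 0 then 1 else phase (θ w)) * Ψ z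

/-- `⨂ w, X ^ (x w)`. -/
def powX (x : W → ZMod 2) (Ψ : QState W) : QState W := fun z => Ψ (z + x)

/-- Apply controlled-`Z` along every edge of `H`. -/
def entangle (H : SimpleGraph W) [DecidableRel H.Adj] (Ψ : QState W) : QState W :=
  fun z => (-1) ^ (H.edgeFinset.filter fun e => ∀ w ∈ e, z w = 1).card * Ψ z

/-- Outcome `b` of measuring qubit `i` with angle `δ`: the projector onto
`(|0⟩ + (-1) ^ b e ^ (i δ) |1⟩) / √2` is applied to qubit `i`.  The squared norm of the result,
relative to that of `Ψ`, is the probability of this outcome. -/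
def project (i : W) (δ : ZMod 8) (b : ZMod 2) (Ψ : QState W) : QState W := fun z =>
  plusKet (δ + bitPi b) (z i) *
    ∑ y : ZMod 2, conj (plusKet (δ + bitPi b) y) * Ψ (Function.update z i y)

open Classical in
/-- The reduced state of the qubits selected by the injection `f`: the partial trace of `|Ψ⟩⟨Ψ|`
over all other qubits. -/
def reduced {O : Type*} (f : O → W) (Ψ : QState W) :
    Matrix (O → ZMod 2) (O → ZMod 2) ℂ := fun z z' =>
  ∑ u : W → ZMod 2, ∑ v : W → ZMod 2,
    if u ∘ f = z ∧ v ∘ f = z' ∧ ∀ w ∉ Set.range f, u w = v w then Ψ u * conj (Ψ v) else 0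

/-- The situation after some measurements, in one branch: the reported outcomes `b`, the record `s`
(`0` where nothing has been recorded), and the unnormalised state, whose squared norm is the
probability of the branch. -/
structure Branch (W : Type*) where
  b : W → ZMod 2
  s : W → ZMod 2
  state : QState W

/-- Qubit `i` is measured with angle `δ i s`, depending on the record `s`; the outcome `β` is
reported, and `s i := β + r i`. -/
def measureStep (δ : W → (W → ZMod 2) → ZMod 8) (r : W → ZMod 2) (i : W)
    (β : ZMod 2) (c : Branch W) : Branch W where
  b := Function.update c.b i β
  s := Function.update c.s i (β + r i)
  state := project i (δ i c.s) β c.state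

/-- All branches of measuring the listed qubits one after the other. -/
def branches (δ : W → (W → ZMod 2) → ZMod 8) (r : W → ZMod 2) :
    List W → Branch W → List (Branch W)
  | [], c => [c]
  | i :: l, c =>
    branches δ r l (measureStep δ r i 0 c) ++ branches δ r l (measureStep δ r i 1 c)

end Registers

/-! ## Measurement patterns -/

/-- A measurement pattern on qubits labelled by `L`: input and output qubits, default measurement
angles, the order in which the non-output qubits are measured, the sets of outcomes on whose parity
the `X`- and `Z`-corrections of each qubit depend (only outcomes obtained earlier; an output qubit
is not in `order`, hence its `idxOf` is the length of `order`), and the classical result read off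
from the outcomes. The quantum part of the result is the corrected state of the output qubits. -/
structure MeasurementPattern (L : Type*) [DecidableEq L] (α : Type*) where
  input : Finset L
  output : Finset L
  angle : L → ZMod 8
  order : List L
  order_nodup : order.Nodup
  mem_order : ∀ i, i ∈ order ↔ i ∉ output
  xDep : L → Finset L
  zDep : L → Finset L
  causal : ∀ i, ∀ j ∈ xDep i ∪ zDep i, order.idxOf j < order.idxOf i
  readout : (L → ZMod 2) → α

namespace MeasurementPattern

variable {L : Type*} [Fintype L] [DecidableEq L] {α : Type*} (M : MeasurementPattern L α)

/-- The exponent of the `X`-correction of qubit `i`, given the outcomes `s`. -/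
def parX (i : L) (s : L → ZMod 2) : ZMod 2 := ∑ j ∈ M.xDep i, s j

/-- The exponent of the `Z`-correction of qubit `i`, given the outcomes `s`. -/
def parZ (i : L) (s : L → ZMod 2) : ZMod 2 := ∑ j ∈ M.zDep i, s j

/-- The corrected angle `(-1) ^ sX φ + sZ π`. -/
def adapted (i : L) (s : L → ZMod 2) : ZMod 8 :=
  bitNeg (M.parX i s) (M.angle i) + bitPi (M.parZ i s)

/-- The input state on the input qubits, `|+⟩` on the others. -/
def start (ψ : QState M.input) : QState L := fun z =>
  ψ (fun i => z i) * ∏ i ∈ M.inputᶜ, plusKet 0 (z i)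

/-- All branches of running the pattern on the graph `H`. -/
def execute (H : SimpleGraph L) [DecidableRel H.Adj] (ψ : QState M.input) : List (Branch L) :=
  branches M.adapted 0 M.order ⟨0, 0, entangle H (M.start ψ)⟩

/-- The corrections `Z ^ sZ X ^ sX` of the output qubits. -/
def correct (s : L → ZMod 2) (Ψ : QState L) : QState L :=
  rotZ (fun i => if i ∈ M.output then bitPi (M.parZ i s) else 0)
    (powX (fun i => if i ∈ M.output then M.parX i s else 0) Ψ)

/-- The result of the pattern: for each classical result `a`, the unnormalised state of the
output qubits, with trace the probability of `a`. -/
def result [DecidableEq α] (H : SimpleGraph L) [DecidableRel H.Adj] (ψ : QState M.input) (a : α) :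
    Matrix (M.output → ZMod 2) (M.output → ZMod 2) ℂ :=
  (((M.execute H ψ).filter fun c => M.readout c.s = a).map fun c =>
    reduced (fun o : M.output => (o : L)) (M.correct c.s c.state)).sum

/-- The pattern, run on `H`, performs the computation `E`, a quantum instrument with classical
results in `α`. For a computation with quantum output only take `α` a one-point type, for one with
classical output only take `output = ∅`. -/
def Performs [DecidableEq α] (H : SimpleGraph L) [DecidableRel H.Adj]
    (E : α → Matrix (M.input → ZMod 2) (M.input → ZMod 2) ℂ →ₗ[ℂ]
      Matrix (M.output → ZMod 2) (M.output → ZMod 2) ℂ) : Prop :=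
  ∀ ψ : QState M.input, weight ψ = 1 → ∀ a, M.result H ψ a = E a (ketBra ψ)

end MeasurementPattern

/-! ## The protocol -/

section Protocol

variable {V : Type*} [Fintype V] [DecidableEq V] {G : SimpleGraph V} [DecidableRel G.Adj]
  {α : Type*}

/-- The verifier's secret choices: a trap-colouring, the angles `θ`, the bits `r`, the bits `d`
(used at the dummies only), the bits `x` (used at the input qubits only), and an order in which the
non-output qubits are measured that follows the order of the pattern on the base-locations and is
arbitrary within each of the sets of qubits with the same base-location. -/
structure Secrets (M : MeasurementPattern (DottedVertex G) α) where
  colouring : TrapColouring G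
  θ : DTVertex G → ZMod 8
  r : DTVertex G → ZMod 2
  d : DTVertex G → ZMod 2
  x : DottedVertex G → ZMod 2
  order : List (DTVertex G)
  order_nodup : order.Nodup
  mem_order : ∀ w, w ∈ order ↔ baseLocation G w ∉ M.output
  order_base : order.Pairwise fun w w' =>
    M.order.idxOf (baseLocation G w) ≤ M.order.idxOf (baseLocation G w')

namespace Secrets

variable {M : MeasurementPattern (DottedVertex G) α} (ν : Secrets M)

/-- `w` carries an input qubit of the computation. -/
def IsInput (w : DTVertex G) : Prop :=
  ν.colouring.colour w = .green ∧ baseLocation G w ∈ M.input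

/-- `w` carries an output qubit of the computation. -/
def IsOutput (w : DTVertex G) : Prop :=
  ν.colouring.colour w = .green ∧ baseLocation G w ∈ M.output

instance : DecidablePred ν.IsInput := fun _ => inferInstanceAs (Decidable (_ ∧ _))

instance : DecidablePred ν.IsOutput := fun _ => inferInstanceAs (Decidable (_ ∧ _))

/-- The sum of the bits `d` over the dummy neighbours of `w`. -/
def dummySum (w : DTVertex G) : ZMod 2 :=
  ∑ u with (dottedTriple G).Adj w u ∧ ν.colouring.IsDummy u, ν.d u

/-- The bit `x` at an input qubit, `0` elsewhere. -/
def inputFlip (w : DTVertex G) : ZMod 2 := if ν.IsInput w then ν.x (baseLocation G w) else 0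

/-- The sum of the bits `x` over the input qubits that are neighbours of `w`. -/
def inputFlipSum (w : DTVertex G) : ZMod 2 :=
  ∑ u with (dottedTriple G).Adj w u, ν.inputFlip u

/-- The single-qubit state sent at `w`, if no input qubit: `|d⟩` at a dummy, and otherwise
`Z ^ (dummySum) |+_θ⟩`. -/
def sentQubit (w : DTVertex G) : ZMod 2 → ℂ := fun z =>
  if ν.colouring.IsDummy w then (if z = ν.d w then 1 else 0)
  else (if z = 0 then 1 else phase (bitPi (ν.dummySum w))) * plusKet (ν.θ w) z

/-- The state sent to the prover: `⨂ X ^ x Z(θ)` applied to the input state on the green input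
qubits, and the single-qubit states `sentQubit` elsewhere. -/
def sent (ψ : QState M.input) : QState (DTVertex G) := fun z =>
  powX (fun i : M.input => ν.x i)
      (rotZ (fun i : M.input => ν.θ (ν.colouring.greenVertex i)) ψ)
      (fun i => z (ν.colouring.greenVertex i)) *
    ∏ w with ¬ ν.IsInput w, ν.sentQubit w (z w)

/-- The honest prover entangles the received qubits according to `DT(G)`. -/
def entangled (ψ : QState M.input) : QState (DTVertex G) := entangle (dottedTriple G) (ν.sent ψ)

/-- The secret rotation about the `Z`-axis of a green qubit after the entangling step: its `θ`,
shifted by `π` for every `X` applied to a neighbouring input qubit and, at an input qubit, for every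
neighbouring dummy in state `|1⟩` (at the other qubits the preparation compensates these). -/
def key (w : DTVertex G) : ZMod 8 :=
  ν.θ w + bitPi (ν.inputFlipSum w) + (if ν.IsInput w then bitPi (ν.dummySum w) else 0)

/-- The angle `δ` that the verifier sends for qubit `w` when the record is `s`. Traps and dummies
have `φ = 0` and no corrections, hence are measured with angle `θ + r π`. -/
def sentAngle (w : DTVertex G) (s : DTVertex G → ZMod 2) : ZMod 8 :=
  if ν.colouring.colour w = .green then
    bitNeg (ν.inputFlip w)
      (M.adapted (baseLocation G w) (s ∘ ν.colouring.greenVertex) + ν.key w) + bitPi (ν.r w)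
  else ν.θ w + bitPi (ν.r w)

/-- The trap qubits among those that the prover returns unmeasured. -/
def outputTraps : List (DTVertex G) :=
  (Finset.univ.filter fun w => ν.colouring.IsTrap w ∧ baseLocation G w ∈ M.output).toList

/-- All branches of the honest run: the prover entangles, then measures the non-output qubits
one by one with the angles it is sent, and the verifier finally measures the output traps. -/
def honestRun (ψ : QState M.input) : List (Branch (DTVertex G)) :=
  branches ν.sentAngle ν.r (ν.order ++ ν.outputTraps) ⟨0, 0, ν.entangled ψ⟩

/-- The verifier accepts if `b = r` at all traps. -/
def Accepts (c : Branch (DTVertex G)) : Prop := ∀ t, ν.colouring.IsTrap t → c.b t = ν.r t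

instance : DecidablePred ν.Accepts := fun c =>
  inferInstanceAs (Decidable (∀ t, ν.colouring.IsTrap t → c.b t = ν.r t))

/-- The probability that the verifier accepts. -/
def acceptProb (ψ : QState M.input) : ℝ :=
  (((ν.honestRun ψ).filter fun c => ν.Accepts c).map fun c => weight c.state).sum

/-- The verifier undoes the encryption of the green output qubits and applies the corrections of
the pattern. -/
def decode (s : DTVertex G → ZMod 2) (Ψ : QState (DTVertex G)) : QState (DTVertex G) :=
  let s' := s ∘ ν.colouring.greenVertex
  rotZ (fun w => if ν.IsOutput w then bitPi (M.parZ (baseLocation G w) s') else 0)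
    (powX (fun w => if ν.IsOutput w then M.parX (baseLocation G w) s' else 0)
      (rotZ (fun w => if ν.IsOutput w then -ν.key w else 0)
        (powX (fun w => if ν.IsOutput w then ν.inputFlip w else 0) Ψ)))

/-- The result of the honest run that the verifier obtains: for each classical result `a`, the
unnormalised state of the decoded green output qubits, with trace the probability of `a`. -/
def result [DecidableEq α] (ψ : QState M.input) (a : α) :
    Matrix (M.output → ZMod 2) (M.output → ZMod 2) ℂ :=
  (((ν.honestRun ψ).filter fun c => M.readout (c.s ∘ ν.colouring.greenVertex) = a).map fun c =>
    reduced (fun o : M.output => ν.colouring.greenVertex o) (ν.decode c.s c.state)).sum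

/-- The graph state on the green copy of `D(G)` that carries the computation, pre-rotated by the
verifier: `Z(θ)` on every qubit, and `X ^ x` and `Z ^ (dummySum)` on the input qubits. -/
def greenState (ψ : QState M.input) : QState (DottedVertex G) :=
  entangle (dotted G)
    (rotZ (fun l => if l ∈ M.input then bitPi (ν.dummySum (ν.colouring.greenVertex l)) else 0)
      (powX (fun l => if l ∈ M.input then ν.x l else 0)
        (rotZ (fun l => ν.θ (ν.colouring.greenVertex l)) (M.start ψ))))

/-- The green state, tensored with `|+_θ⟩` at each trap and `|d⟩` at each dummy. -/
def brokenState (ψ : QState M.input) : QState (DTVertex G) := fun z =>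
  ν.greenState ψ (z ∘ ν.colouring.greenVertex) *
    (∏ t with ν.colouring.IsTrap t, plusKet (ν.θ t) (z t)) *
    ∏ w with ν.colouring.IsDummy w, if z w = ν.d w then 1 else 0

end Secrets

end Protocol

end

/-!
The structural claims are a matter of colours. Each of the colours white, black and green occurs
exactly once at every base-location (`TrapColouring.existsUnique_colour`), and every neighbour of a
trap is a dummy (`TrapColouring.not_adj_of_isTrap`).

Controlled-`Z` gates multiply an amplitude by the sign given by `edgeParity`, which over `𝔽₂` is a
quadratic form (`edgeParity_add`). Splitting an assignment of bits into dummies and the rest, its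
polar form says that a dummy in state `|1⟩` acts as `Z` on its neighbours; this is what breaks the
state into green part, traps and dummies (`Secrets.exists_entangled_eq_brokenState`). Splitting off
the bit flips `x` instead, it says that these pass the gates at the cost of `Z`s on the neighbours;
hence the green part is the graph state of the pattern up to `X ^ x Z(key)` on each qubit and a sign
(`Secrets.exists_greenState_eq_encrypt`).

A trap is in the state `|+_θ⟩`, in tensor product with all other qubits, and keeps it until it is
measured with angle `θ + r π`, so that the outcome must be `r` (`outcome_eq_of_project_eq_zero`).

For the output, a measurement with the angle sent, behind `X ^ x Z(key)`, is the measurement of the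
pattern with the outcome flipped by `r` (`Secrets.project_encrypt`), and the green qubits are
measured in the order of the pattern (`Secrets.map_filter_order`). By induction on the list of
measurements, the sum over the branches of the protocol is that over the branches of the pattern,
because the traps and dummies contribute complementary projectors (`Secrets.sum_branches_eq`).
Decoding removes `X ^ x Z(key)` from the output qubits, and on the other qubits it is a local
unitary, invisible after the partial trace (`Secrets.reduced_decode`).
-/

/-! ### Trap-colourings -/

namespace TrapColouring

variable {V : Type*} {G : SimpleGraph V} (κ : TrapColouring G)

theorem colour_added_iff {e : (tripleGraph G).edgeSet} {c : Colour} (hc : c ≠ .red) :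
    κ.colour (.inr e) = c ↔ ∀ p ∈ e.1, κ.colour (.inl p) = c := by
  refine ⟨fun h p hp => ?_, κ.added_same e c⟩
  have hall : ∀ q ∈ e.1, κ.colour (.inl q) = κ.colour (.inl p) := by
    intro q hq
    by_contra hne
    exact hc (h ▸ κ.added_diff e q hq p hp hne)
  rw [← κ.added_same e _ hall, h]

/-- Each of the colours white, black and green occurs exactly once at every base-location: at an
edge, on the added vertex between the two primary vertices of that colour. -/
theorem existsUnique_colour {c : Colour} (hc : c ≠ .red) (l : DottedVertex G) :
    ∃! w, baseLocation G w = l ∧ κ.colour w = c := by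
  have hu : ∀ {p q : V × Fin 3}, κ.colour (.inl p) = c → κ.colour (.inl q) = c → p.1 = q.1 →
      p = q := by
    rintro ⟨v, j⟩ ⟨w, k⟩ hp hq (rfl : v = w)
    rw [(κ.primary_unique v c hc).unique hp hq]
  rcases l with v | ⟨e, he⟩
  · obtain ⟨k, hk, -⟩ := κ.primary_unique v c hc
    refine ⟨.inl (v, k), ⟨rfl, hk⟩, ?_⟩
    rintro (p | e) ⟨hb, hcol⟩
    · exact congrArg Sum.inl (hu hcol hk (Sum.inl_injective hb))
    · cases hb
  · induction e using Sym2.ind with | _ v w => ?_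
    obtain ⟨j, hj, -⟩ := κ.primary_unique v c hc
    obtain ⟨k, hk, -⟩ := κ.primary_unique w c hc
    refine ⟨.inr ⟨s((v, j), (w, k)), he⟩, ⟨rfl, ?_⟩, ?_⟩
    · rw [κ.colour_added_iff hc]
      intro p hp
      rcases Sym2.mem_iff.1 hp with rfl | rfl <;> assumption
    · rintro (p | ⟨e', he'⟩) ⟨hb, hcol⟩
      · cases hb
      · induction e' using Sym2.ind with | _ p q => ?_
        rw [κ.colour_added_iff hc] at hcol
        have hp := hcol p (Sym2.mem_mk_left _ _)
        have hq := hcol q (Sym2.mem_mk_right _ _)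
        have hs : s(p.1, q.1) = s(v, w) := congrArg Subtype.val (Sum.inr_injective hb)
        congr 2
        rcases Sym2.eq_iff.1 hs with ⟨h1, h2⟩ | ⟨h1, h2⟩
        · rw [hu hp hj h1, hu hq hk h2]
        · rw [hu hp hk h1, hu hq hj h2, Sym2.eq_swap]

theorem colour_greenHom (v : V) : κ.colour (.inl (κ.greenHom v)) = .green :=
  (κ.primary_unique v .green (by decide)).choose_spec.1

theorem colour_greenVertex (l : DottedVertex G) : κ.colour (κ.greenVertex l) = .green := by
  rcases l with v | e
  · exact κ.colour_greenHom v
  · refine κ.added_same _ _ fun p hp => ?_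
    obtain ⟨v, -, rfl⟩ := Sym2.mem_map.1 hp
    exact κ.colour_greenHom v

theorem baseLocation_greenVertex (l : DottedVertex G) :
    baseLocation G (κ.greenVertex l) = l := by
  rcases l with v | ⟨e, he⟩
  · rfl
  · refine congrArg Sum.inr (Subtype.ext ?_)
    change Sym2.map _ (Sym2.map _ e) = e
    rw [Sym2.map_map]
    exact congrFun Sym2.map_id e

theorem greenVertex_baseLocation {w : DTVertex G} (hw : κ.colour w = .green) :
    κ.greenVertex (baseLocation G w) = w :=
  (κ.existsUnique_colour (c := .green) (by decide) (baseLocation G w)).unique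
    ⟨κ.baseLocation_greenVertex _, κ.colour_greenVertex _⟩ ⟨rfl, hw⟩

theorem greenVertex_injective : Function.Injective κ.greenVertex :=
  Function.LeftInverse.injective κ.baseLocation_greenVertex

theorem greenHom_injective : Function.Injective κ.greenHom := fun _ _ h => congrArg Prod.fst h

theorem adj_greenVertex {l l' : DottedVertex G} :
    (dottedTriple G).Adj (κ.greenVertex l) (κ.greenVertex l') ↔ (dotted G).Adj l l' := by
  have key : ∀ (v : V) (e : G.edgeSet),
      κ.greenHom v ∈ (κ.greenHom.mapEdgeSet e).1 ↔ v ∈ e.1 := by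
    intro v e
    refine Sym2.mem_map.trans ⟨?_, fun h => ⟨v, h, rfl⟩⟩
    rintro ⟨w, hw, h⟩
    exact κ.greenHom_injective h ▸ hw
  rcases l with v | e <;> rcases l' with w | f
  · exact Iff.rfl
  · exact key v f
  · exact key w e
  · exact Iff.rfl

/-- The green vertices induce a copy of `D(G)`. -/
noncomputable def greenIso : dotted G ≃g (dottedTriple G).induce {w | κ.colour w = .green} where
  toFun l := ⟨κ.greenVertex l, κ.colour_greenVertex l⟩
  invFun w := baseLocation G w
  left_inv := κ.baseLocation_greenVertex
  right_inv w := Subtype.ext (κ.greenVertex_baseLocation w.2)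
  map_rel_iff' := κ.adj_greenVertex

theorem green_or_trap_or_dummy (w : DTVertex G) :
    (κ.colour w = .green ∧ ¬ κ.IsTrap w ∧ ¬ κ.IsDummy w) ∨
      (κ.colour w ≠ .green ∧ κ.IsTrap w ∧ ¬ κ.IsDummy w) ∨
      (κ.colour w ≠ .green ∧ ¬ κ.IsTrap w ∧ κ.IsDummy w) := by
  rcases w with p | e
  · have := κ.primary_ne_red p
    cases h : κ.colour (.inl p) <;> simp_all [IsTrap, IsDummy]
  · cases h : κ.colour (.inr e) <;> simp_all [IsTrap, IsDummy]

theorem IsTrap.colour_ne {κ : TrapColouring G} {w : DTVertex G} (hw : κ.IsTrap w) :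
    κ.colour w ≠ .green := by
  rcases κ.green_or_trap_or_dummy w with h | h | h <;> simp_all

theorem IsTrap.not_isDummy {κ : TrapColouring G} {w : DTVertex G} (hw : κ.IsTrap w) :
    ¬ κ.IsDummy w := by
  rcases κ.green_or_trap_or_dummy w with h | h | h <;> simp_all

theorem IsDummy.colour_ne {κ : TrapColouring G} {w : DTVertex G} (hw : κ.IsDummy w) :
    κ.colour w ≠ .green := by
  rcases κ.green_or_trap_or_dummy w with h | h | h <;> simp_all

theorem existsUnique_trap (l : DottedVertex G) :
    ∃! t, baseLocation G t = l ∧ κ.IsTrap t := by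
  rcases l with v | e
  · convert κ.existsUnique_colour (c := .white) (by decide) (.inl v) using 2 with t
    rcases t with p | f
    · exact Iff.rfl
    · simp [baseLocation]
  · convert κ.existsUnique_colour (c := .black) (by decide) (.inr e) using 2 with t
    rcases t with p | f
    · simp [baseLocation]
    · exact Iff.rfl

/-- The neighbours of a white primary vertex are white or red added vertices, those of a black added
vertex are black primary vertices: all of them are dummies. -/
theorem not_adj_of_isTrap {t w : DTVertex G} (ht : κ.IsTrap t) (hw : ¬ κ.IsDummy w) :
    ¬ (dottedTriple G).Adj t w := by
  intro h
  rcases t with p | e <;> rcases w with q | f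
  · exact h
  · have hp : κ.colour (.inl p) = .white := ht
    have hf : ¬ (κ.colour (.inr f) = .red ∨ κ.colour (.inr f) = .white) := hw
    have hred : κ.colour (.inr f) ≠ .red := fun h' => hf (.inl h')
    have hpf := (κ.colour_added_iff hred).1 rfl p h
    exact hf (.inr (hpf.symm.trans hp))
  · exact hw ((κ.colour_added_iff (by decide)).1 (show κ.colour (.inr e) = .black from ht) q h)
  · exact h

end TrapColouring

/-! ### Phases and single-qubit states -/

theorem phase_eq_stdAddChar (k : ZMod 8) : phase k = ZMod.stdAddChar k := by
  rw [ZMod.stdAddChar_apply, ZMod.toCircle_apply, phase]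
  congr 1
  push_cast
  ring

theorem phase_zero : phase 0 = 1 := by simp [phase]

theorem phase_add (k l : ZMod 8) : phase (k + l) = phase k * phase l := by
  simp only [phase_eq_stdAddChar, AddChar.map_add_eq_mul]

theorem phase_sum {ι : Type*} (s : Finset ι) (g : ι → ZMod 8) :
    phase (∑ i ∈ s, g i) = ∏ i ∈ s, phase (g i) := by
  classical
  induction s using Finset.induction_on with
  | empty => simp [phase_zero]
  | insert i s hi ih => rw [Finset.sum_insert hi, Finset.prod_insert hi, phase_add, ih]

theorem norm_phase (k : ZMod 8) : ‖phase k‖ = 1 := by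
  rw [phase_eq_stdAddChar, ZMod.stdAddChar_apply, Circle.norm_coe]

theorem phase_mul_conj (k l : ZMod 8) : phase k * conj (phase l) = phase (k - l) := by
  have h : conj (phase l) = phase (-l) := by
    simp only [phase_eq_stdAddChar]
    exact (AddChar.map_neg_eq_conj _ _).symm
  rw [h, ← phase_add, sub_eq_add_neg]

theorem phase_mul_conj_self (k : ZMod 8) : phase k * conj (phase k) = 1 := by
  rw [phase_mul_conj, sub_self, phase_zero]

theorem phase_four : phase 4 = -1 := by
  have h : ((4 : ZMod 8).val : ℂ) * (Real.pi / 4) * Complex.I = Real.pi * Complex.I := by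
    rw [show (4 : ZMod 8).val = 4 from rfl]
    push_cast
    ring
  rw [phase, h, Complex.exp_pi_mul_I]

theorem zmod_two_cases (b : ZMod 2) : b = 0 ∨ b = 1 := by
  revert b
  decide

theorem bitPi_zero : bitPi 0 = 0 := rfl

theorem bitPi_add (a b : ZMod 2) : bitPi (a + b) = bitPi a + bitPi b := by
  revert a b
  decide

theorem bitPi_sum {ι : Type*} (s : Finset ι) (g : ι → ZMod 2) :
    bitPi (∑ i ∈ s, g i) = ∑ i ∈ s, bitPi (g i) :=
  map_sum (AddMonoidHom.mk' bitPi bitPi_add) g s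

theorem neg_one_pow_eq_phase (n : ℕ) : (-1 : ℂ) ^ n = phase (bitPi (n : ZMod 2)) := by
  induction n with
  | zero => simp [bitPi_zero, phase_zero]
  | succ n ih =>
    rw [pow_succ, ih, Nat.cast_succ, bitPi_add, phase_add, show bitPi 1 = 4 from rfl, phase_four]

theorem sum_zmod_two {A : Type*} [AddCommMonoid A] (g : ZMod 2 → A) : ∑ y, g y = g 0 + g 1 :=
  Fin.sum_univ_two g

theorem plusKet_eq_phase (θ : ZMod 8) (z : ZMod 2) :
    plusKet θ z = phase (if z = 0 then 0 else θ) / (√2 : ℝ) := by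
  rcases zmod_two_cases z with rfl | rfl <;> simp [plusKet, phase_zero]

theorem sqrt_two_mul_self : ((√2 : ℝ) : ℂ) * ((√2 : ℝ) : ℂ) = 2 := by
  rw [← Complex.ofReal_mul, Real.mul_self_sqrt (by norm_num)]
  norm_num

/-- The matrix entries of the projector `|+_θ⟩⟨+_θ|`. -/
theorem plusKet_mul_conj (θ : ZMod 8) (y z : ZMod 2) :
    plusKet θ y * conj (plusKet θ z) =
      phase ((if y = 0 then 0 else θ) - if z = 0 then 0 else θ) / 2 := by
  rw [plusKet_eq_phase, plusKet_eq_phase, map_div₀, Complex.conj_ofReal, div_mul_div_comm,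
    phase_mul_conj, sqrt_two_mul_self]

theorem norm_sq_plusKet (θ : ZMod 8) (z : ZMod 2) : ‖plusKet θ z‖ ^ 2 = 1 / 2 := by
  rw [plusKet_eq_phase, norm_div, norm_phase, Complex.norm_real, Real.norm_eq_abs, div_pow, sq_abs,
    Real.sq_sqrt (by norm_num), one_pow]

/-- The squared norm of a single-qubit vector. -/
noncomputable def qubitWeight (q : ZMod 2 → ℂ) : ℝ := ∑ y, ‖q y‖ ^ 2

theorem qubitWeight_plusKet (θ : ZMod 8) : qubitWeight (plusKet θ) = 1 := by
  rw [qubitWeight, sum_zmod_two, norm_sq_plusKet, norm_sq_plusKet]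
  norm_num

theorem qubitWeight_basis (d : ZMod 2) : qubitWeight (fun z => if z = d then 1 else 0) = 1 := by
  rw [qubitWeight, sum_zmod_two]
  rcases zmod_two_cases d with rfl | rfl <;> simp

/-- The projector of a measurement with angle `δ` and outcome `b`, on a single qubit. -/
noncomputable def qubitProject (δ : ZMod 8) (b : ZMod 2) (q : ZMod 2 → ℂ) (z : ZMod 2) : ℂ :=
  plusKet (δ + bitPi b) z * ∑ y, conj (plusKet (δ + bitPi b) y) * q y

/-- The two outcomes of a measurement are complementary projectors. -/
theorem qubitWeight_qubitProject (δ : ZMod 8) (q : ZMod 2 → ℂ) :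
    qubitWeight (qubitProject δ 0 q) + qubitWeight (qubitProject δ 1 q) = qubitWeight q := by
  have h2 : ((√2 : ℝ) : ℂ) ≠ 0 := by simp
  have hw : ∀ b, qubitWeight (qubitProject δ b q) =
      ‖q 0 + phase (bitPi b) * (conj (phase δ) * q 1)‖ ^ 2 / 2 := by
    intro b
    have hb : conj (phase (bitPi b)) = phase (bitPi b) := by
      rcases zmod_two_cases b with rfl | rfl
      · simp [bitPi, phase_zero]
      · simp [bitPi, phase_four]
    have hs : ∑ y, conj (plusKet (δ + bitPi b) y) * q y =
        (q 0 + phase (bitPi b) * (conj (phase δ) * q 1)) / (√2 : ℝ) := by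
      rw [sum_zmod_two]
      simp only [plusKet, if_true, one_ne_zero, if_false, phase_add, map_div₀, map_mul, map_one,
        Complex.conj_ofReal, hb]
      ring
    have hn : ‖((√2 : ℝ) : ℂ)‖ ^ 2 = 2 := by
      rw [Complex.norm_real, Real.norm_eq_abs, sq_abs, Real.sq_sqrt (by norm_num)]
    simp only [qubitWeight, qubitProject, hs, norm_mul, mul_pow, norm_sq_plusKet, norm_div,
      div_pow, hn, sum_zmod_two]
    ring
  rw [hw, hw, show bitPi 0 = 0 from rfl, show bitPi 1 = 4 from rfl, phase_zero, phase_four,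
    qubitWeight, sum_zmod_two, one_mul, neg_one_mul, ← sub_eq_add_neg]
  have hp := parallelogram_law_with_norm ℝ (q 0) (conj (phase δ) * q 1)
  rw [norm_mul, RCLike.norm_conj, norm_phase, one_mul] at hp
  linarith [hp]

/-! ### Operations on registers -/

section Registers

variable {W : Type*}

theorem powX_powX (x y : W → ZMod 2) (Ψ : QState W) : powX x (powX y Ψ) = powX (x + y) Ψ := by
  funext z
  simp only [powX, add_assoc]

section Project

variable [DecidableEq W]

theorem project_apply (i : W) (δ : ZMod 8) (b : ZMod 2) (Ψ : QState W) (z : W → ZMod 2) :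
    project i δ b Ψ z = qubitProject δ b (fun y => Ψ (Function.update z i y)) (z i) := rfl

theorem project_add_bitPi (i : W) (δ : ZMod 8) (r b : ZMod 2) (Ψ : QState W) :
    project i (δ + bitPi r) b Ψ = project i δ (b + r) Ψ := by
  funext z
  simp only [project, bitPi_add, add_assoc, add_comm (bitPi r)]

theorem project_smul (i : W) (δ : ZMod 8) (b : ZMod 2) (c : ℂ) (Ψ : QState W) :
    project i δ b (c • Ψ) = c • project i δ b Ψ := by
  funext z
  simp only [project, Pi.smul_apply, smul_eq_mul, Finset.mul_sum]
  exact Finset.sum_congr rfl fun y _ => by ring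

theorem project_zero (i : W) (δ : ZMod 8) (b : ZMod 2) : project i δ b (0 : QState W) = 0 := by
  funext z
  simp [project]

/-- Measurements of different qubits commute. -/
theorem project_comm {i j : W} (hij : i ≠ j) (δ ε : ZMod 8) (b c : ZMod 2) (Ψ : QState W) :
    project i δ b (project j ε c Ψ) = project j ε c (project i δ b Ψ) := by
  funext z
  simp only [project, Function.update_of_ne hij, Function.update_of_ne hij.symm, Finset.mul_sum]
  rw [Finset.sum_comm]
  refine Finset.sum_congr rfl fun y _ => Finset.sum_congr rfl fun y' _ => ?_
  rw [Function.update_comm hij]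
  ring

/-- Measuring behind `X ^ x` amounts to measuring with the angle `(-1) ^ x δ`. -/
theorem project_powX (i : W) (δ : ZMod 8) (b : ZMod 2) (x : W → ZMod 2) (Ψ : QState W) :
    project i δ b (powX x Ψ) = powX x (project i (bitNeg (x i) δ) b Ψ) := by
  have hupd : ∀ (z : W → ZMod 2) y,
      Function.update z i y + x = Function.update (z + x) i (y + x i) := by
    intro z y
    funext w
    rcases eq_or_ne w i with rfl | hw
    · simp
    · simp [hw]
  have hket : ∀ y y' : ZMod 2,
      plusKet (δ + bitPi b) y * conj (plusKet (δ + bitPi b) y') =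
        plusKet (bitNeg (x i) δ + bitPi b) (y + x i) *
          conj (plusKet (bitNeg (x i) δ + bitPi b) (y' + x i)) := by
    intro y y'
    rw [plusKet_mul_conj, plusKet_mul_conj]
    congr 2
    generalize x i = t
    revert δ b y y' t
    decide
  funext z
  simp only [project, powX, Finset.mul_sum, Pi.add_apply]
  refine Fintype.sum_equiv (Equiv.addRight (x i)) _ _ fun y => ?_
  rw [Equiv.coe_addRight, hupd, ← mul_assoc, ← mul_assoc, hket]

end Project

variable [Fintype W]

theorem prod_ite_phase (θ : W → ZMod 8) (z : W → ZMod 2) :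
    (∏ w, if z w = 0 then (1 : ℂ) else phase (θ w)) =
      phase (∑ w, if z w = 0 then 0 else θ w) := by
  rw [phase_sum]
  refine Finset.prod_congr rfl fun w _ => ?_
  split_ifs
  · exact phase_zero.symm
  · rfl

theorem rotZ_apply (θ : W → ZMod 8) (Ψ : QState W) (z : W → ZMod 2) :
    rotZ θ Ψ z = phase (∑ w, if z w = 0 then 0 else θ w) * Ψ z := by
  rw [rotZ, prod_ite_phase]

theorem rotZ_rotZ (θ θ' : W → ZMod 8) (Ψ : QState W) : rotZ θ (rotZ θ' Ψ) = rotZ (θ + θ') Ψ := by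
  funext z
  rw [rotZ_apply, rotZ_apply, rotZ_apply, ← mul_assoc, ← phase_add, ← Finset.sum_add_distrib]
  congr 2
  refine Finset.sum_congr rfl fun w _ => ?_
  split_ifs
  · exact add_zero 0
  · rfl

/-- Rotations and bit flips of different qubits commute. -/
theorem rotZ_powX {θ : W → ZMod 8} {x : W → ZMod 2} (h : ∀ w, θ w = 0 ∨ x w = 0) (Ψ : QState W) :
    rotZ θ (powX x Ψ) = powX x (rotZ θ Ψ) := by
  funext z
  simp only [rotZ_apply, powX]
  congr 2
  refine Finset.sum_congr rfl fun w _ => ?_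
  rcases h w with h | h <;> simp [h]

theorem rotZ_smul (θ : W → ZMod 8) (c : ℂ) (Ψ : QState W) : rotZ θ (c • Ψ) = c • rotZ θ Ψ := by
  funext z
  simp only [rotZ_apply, Pi.smul_apply, smul_eq_mul]
  ring

variable [DecidableEq W]

/-- Measuring behind `Z(θ)` amounts to shifting the measurement angle by `-θ`. -/
theorem project_rotZ (i : W) (δ : ZMod 8) (b : ZMod 2) (θ : W → ZMod 8) (Ψ : QState W) :
    project i δ b (rotZ θ Ψ) = rotZ θ (project i (δ - θ i) b Ψ) := by
  have hsum : ∀ (z : W → ZMod 2) y, (∑ w, if Function.update z i y w = 0 then 0 else θ w) =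
      (if y = 0 then 0 else θ i) +
        ∑ w ∈ Finset.univ.erase i, if z w = 0 then 0 else θ w := by
    intro z y
    rw [← Finset.add_sum_erase _ _ (Finset.mem_univ i), Function.update_self]
    refine congrArg _ (Finset.sum_congr rfl fun w hw => ?_)
    rw [Function.update_of_ne (Finset.ne_of_mem_erase hw)]
  funext z
  rw [rotZ_apply]
  simp only [project, rotZ_apply, Finset.mul_sum]
  refine Finset.sum_congr rfl fun y _ => ?_
  have hz := hsum z (z i)
  rw [Function.update_eq_self] at hz
  rw [hz, hsum z y, phase_add, phase_add]
  have hket : plusKet (δ + bitPi b) (z i) * conj (plusKet (δ + bitPi b) y) *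
      phase (if y = 0 then 0 else θ i) = phase (if z i = 0 then 0 else θ i) *
        (plusKet (δ - θ i + bitPi b) (z i) * conj (plusKet (δ - θ i + bitPi b) y)) := by
    rw [plusKet_mul_conj, plusKet_mul_conj, div_mul_eq_mul_div, ← phase_add, ← mul_div_assoc,
      ← phase_add]
    congr 2
    split_ifs <;> ring
  linear_combination (phase (∑ w ∈ Finset.univ.erase i, if z w = 0 then 0 else θ w) *
    Ψ (Function.update z i y)) * hket

theorem weight_zero : weight (0 : QState W) = 0 := by simp [weight]

theorem weight_smul (c : ℂ) (Ψ : QState W) : weight (c • Ψ) = ‖c‖ ^ 2 * weight Ψ := by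
  simp [weight, mul_pow, Finset.mul_sum]

theorem weight_powX (x : W → ZMod 2) (Ψ : QState W) : weight (powX x Ψ) = weight Ψ :=
  Fintype.sum_equiv (Equiv.addRight x) _ _ fun _ => rfl

theorem weight_rotZ (θ : W → ZMod 8) (Ψ : QState W) : weight (rotZ θ Ψ) = weight Ψ := by
  simp only [weight, rotZ_apply, norm_mul, norm_phase, one_mul]

theorem weight_entangle (H : SimpleGraph W) [DecidableRel H.Adj] (Ψ : QState W) :
    weight (entangle H Ψ) = weight Ψ := by
  simp [weight, entangle]

theorem sum_sum_update (i : W) (g : (W → ZMod 2) → ℝ) :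
    ∑ z, ∑ y, g (Function.update z i y) = 2 * ∑ z, g z := by
  have h : ∀ c : ZMod 2, ∑ z : W → ZMod 2, g (Function.update z i (z i + c)) = ∑ z, g z := by
    intro c
    refine Fintype.sum_equiv (Equiv.addRight (Pi.single i c)) _ _ fun z => congrArg g ?_
    funext w
    rcases eq_or_ne w i with rfl | hw
    · simp
    · simp [hw]
  calc ∑ z, ∑ y, g (Function.update z i y)
      = ∑ z : W → ZMod 2, ∑ c, g (Function.update z i (z i + c)) :=
        Finset.sum_congr rfl fun z _ => (Equiv.sum_comp (Equiv.addLeft (z i))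
          fun y => g (Function.update z i y)).symm
    _ = 2 * ∑ z, g z := by
        rw [Finset.sum_comm, sum_zmod_two, h, h, two_mul]

/-- The probabilities of the two outcomes of a measurement add up to that of the situation before
it. -/
theorem weight_project (i : W) (δ : ZMod 8) (Ψ : QState W) :
    weight (project i δ 0 Ψ) + weight (project i δ 1 Ψ) = weight Ψ := by
  have hupd : ∀ b, 2 * weight (project i δ b Ψ) =
      ∑ z, qubitWeight (qubitProject δ b fun y => Ψ (Function.update z i y)) := by
    intro b
    rw [weight, ← sum_sum_update i]
    refine Finset.sum_congr rfl fun z _ => ?_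
    simp only [qubitWeight, project_apply, Function.update_idem, Function.update_self]
  have h := sum_sum_update i fun z => ‖Ψ z‖ ^ 2
  have h' : 2 * (weight (project i δ 0 Ψ) + weight (project i δ 1 Ψ)) = 2 * weight Ψ := by
    rw [mul_add, hupd, hupd, ← Finset.sum_add_distrib, weight, ← h]
    exact Finset.sum_congr rfl fun z _ => qubitWeight_qubitProject δ _
  linarith

section Reduced

variable {O : Type*} (f : O → W)

theorem reduced_smul (c : ℂ) (Ψ : QState W) :
    reduced f (c • Ψ) = ((‖c‖ ^ 2 : ℝ) : ℂ) • reduced f Ψ := by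
  funext z z'
  simp only [reduced, Pi.smul_apply, Matrix.smul_apply, smul_eq_mul, Finset.mul_sum]
  refine Finset.sum_congr rfl fun u _ => Finset.sum_congr rfl fun v _ => ?_
  rw [mul_ite, mul_zero, ← Complex.normSq_eq_norm_sq, ← Complex.mul_conj, map_mul]
  congr 1
  ring

/-- Bit flips of the qubits that are traced out do not change a reduced state. -/
theorem reduced_powX {x : W → ZMod 2} (hx : ∀ o, x (f o) = 0) (Ψ : QState W) :
    reduced f (powX x Ψ) = reduced f Ψ := by
  have hcomp : ∀ u : W → ZMod 2, (u + x) ∘ f = u ∘ f := fun u => by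
    funext o
    simp [hx]
  funext z z'
  refine Fintype.sum_equiv (Equiv.addRight x) _ _ fun u =>
    Fintype.sum_equiv (Equiv.addRight x) _ _ fun v => ?_
  classical
  rw [Equiv.coe_addRight, hcomp, hcomp]
  simp only [powX, Pi.add_apply, add_left_inj]

/-- Rotations about the `Z`-axis of the qubits that are traced out do not change a reduced state. -/
theorem reduced_rotZ {θ : W → ZMod 8} (hθ : ∀ o, θ (f o) = 0) (Ψ : QState W) :
    reduced f (rotZ θ Ψ) = reduced f Ψ := by
  funext z z'
  refine Finset.sum_congr rfl fun u _ => Finset.sum_congr rfl fun v _ => ?_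
  split_ifs with h
  · have hs : (∑ w, if u w = 0 then 0 else θ w) = ∑ w, if v w = 0 then 0 else θ w := by
      refine Finset.sum_congr rfl fun w _ => ?_
      by_cases hw : w ∈ Set.range f
      · obtain ⟨o, rfl⟩ := hw
        simp [hθ]
      · rw [h.2.2 w hw]
    rw [rotZ_apply, rotZ_apply, hs, map_mul, mul_mul_mul_comm, phase_mul_conj_self, one_mul]
  · rfl

end Reduced

end Registers

/-! ### Registers with a distinguished part -/

section TensorAlong

variable {L W : Type*} [Fintype L] [Fintype W] [DecidableEq W] {f : L → W}

/-- The product state with `Φ` on the qubits selected by the injection `f`, and the single-qubit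
state `q w` at every other qubit `w`. -/
def tensorAlong (f : L → W) (Φ : QState L) (q : W → ZMod 2 → ℂ) : QState W := fun z =>
  Φ (z ∘ f) * ∏ w ∈ (Finset.univ.image f)ᶜ, q w (z w)

theorem notMem_compl_image (f : L → W) (l : L) : f l ∉ (Finset.univ.image f)ᶜ := by simp

theorem project_tensorAlong_of_notMem_range {w : W} (hw : ∀ l, f l ≠ w) (δ : ZMod 8) (b : ZMod 2)
    (Φ : QState L) (q : W → ZMod 2 → ℂ) :
    project w δ b (tensorAlong f Φ q) =
      tensorAlong f Φ (Function.update q w (qubitProject δ b (q w))) := by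
  have hmem : w ∈ (Finset.univ.image f)ᶜ := by simpa using hw
  funext z
  have hz : ∀ y, Function.update z w y ∘ f = z ∘ f := fun y => by
    funext l
    exact Function.update_of_ne (hw l) _ _
  simp only [project, tensorAlong, hz, ← Finset.mul_prod_erase _ _ hmem, Function.update_self,
    qubitProject]
  have herase : ∀ y, ∏ v ∈ (Finset.univ.image f)ᶜ.erase w, q v (Function.update z w y v) =
      ∏ v ∈ (Finset.univ.image f)ᶜ.erase w, q v (z v) := fun y =>
    Finset.prod_congr rfl fun v hv => by rw [Function.update_of_ne (Finset.ne_of_mem_erase hv)]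
  have herase' : ∀ q', ∏ v ∈ (Finset.univ.image f)ᶜ.erase w, Function.update q w q' v (z v) =
      ∏ v ∈ (Finset.univ.image f)ᶜ.erase w, q v (z v) := fun q' =>
    Finset.prod_congr rfl fun v hv => by rw [Function.update_of_ne (Finset.ne_of_mem_erase hv)]
  rw [herase']
  simp only [herase, Finset.mul_sum, Finset.sum_mul]
  exact Finset.sum_congr rfl fun y _ => by ring

theorem tensorAlong_congr (Φ : QState L) {q q' : W → ZMod 2 → ℂ}
    (h : ∀ w ∈ (Finset.univ.image f)ᶜ, q w = q' w) : tensorAlong f Φ q = tensorAlong f Φ q' := by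
  funext z
  exact congrArg _ (Finset.prod_congr rfl fun w hw => by rw [h w hw])

theorem powX_tensorAlong (x : W → ZMod 2) (Φ : QState L) (q : W → ZMod 2 → ℂ) :
    powX x (tensorAlong f Φ q) =
      tensorAlong f (powX (x ∘ f) Φ) fun w y => q w (y + x w) := rfl

theorem powX_tensorAlong_of_support {x : W → ZMod 2}
    (hx : ∀ w ∈ (Finset.univ.image f)ᶜ, x w = 0) (Φ : QState L) (q : W → ZMod 2 → ℂ) :
    powX x (tensorAlong f Φ q) = tensorAlong f (powX (x ∘ f) Φ) q := by
  rw [powX_tensorAlong]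
  exact tensorAlong_congr _ fun w hw => by simp [hx w hw]

theorem rotZ_tensorAlong (hf : f.Injective) (θ : W → ZMod 8) (Φ : QState L)
    (q : W → ZMod 2 → ℂ) :
    rotZ θ (tensorAlong f Φ q) = tensorAlong f (rotZ (θ ∘ f) Φ) fun w y =>
      phase (if y = 0 then 0 else θ w) * q w y := by
  funext z
  simp only [tensorAlong, rotZ_apply, Finset.prod_mul_distrib, ← phase_sum]
  rw [← Finset.sum_add_sum_compl (Finset.univ.image f), Finset.sum_image hf.injOn, phase_add]
  exact mul_mul_mul_comm _ _ _ _

theorem rotZ_tensorAlong_of_support (hf : f.Injective) {θ : W → ZMod 8}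
    (hθ : ∀ w ∈ (Finset.univ.image f)ᶜ, θ w = 0) (Φ : QState L) (q : W → ZMod 2 → ℂ) :
    rotZ θ (tensorAlong f Φ q) = tensorAlong f (rotZ (θ ∘ f) Φ) q := by
  rw [rotZ_tensorAlong hf]
  exact tensorAlong_congr _ fun w hw => by simp [hθ w hw, phase_zero]

variable [DecidableEq L]

theorem sum_comp_mul_prod (hf : f.Injective) {R : Type*} [CommSemiring R]
    (g : (L → ZMod 2) → R) (p : W → ZMod 2 → R) :
    ∑ u : W → ZMod 2, g (u ∘ f) * ∏ w ∈ (Finset.univ.image f)ᶜ, p w (u w) =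
      (∑ a, g a) * ∏ w ∈ (Finset.univ.image f)ᶜ, ∑ y, p w y := by
  classical
  let S := Finset.univ.image f
  let e : L ≃ {w // w ∈ S} := Equiv.ofBijective
    (fun l => ⟨f l, Finset.mem_image_of_mem f (Finset.mem_univ l)⟩)
    ⟨fun a b h => hf (congrArg Subtype.val h), fun w => by
      obtain ⟨l, -, hl⟩ := Finset.mem_image.1 w.2
      exact ⟨l, Subtype.ext hl⟩⟩
  have hS : ∀ P : W → R, ∏ w ∈ Sᶜ, P w = ∏ w : {w // w ∉ S}, P w := fun P =>
    Finset.prod_subtype _ (fun w => Finset.mem_compl) P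
  rw [hS, Finset.prod_univ_sum, Fintype.piFinset_univ, Finset.sum_mul_sum, ← Finset.sum_product',
    Finset.univ_product_univ]
  refine Fintype.sum_equiv ((Equiv.piEquivPiSubtypeProd (· ∈ S) fun _ => ZMod 2).trans
    (Equiv.prodCongr (Equiv.arrowCongr e.symm (Equiv.refl _)) (Equiv.refl _))) _ _ fun u => ?_
  rw [hS]
  rfl

theorem weight_tensorAlong (hf : f.Injective) (Φ : QState L) (q : W → ZMod 2 → ℂ) :
    weight (tensorAlong f Φ q) =
      weight Φ * ∏ w ∈ (Finset.univ.image f)ᶜ, qubitWeight (q w) := by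
  simp only [weight, qubitWeight, ← sum_comp_mul_prod hf, tensorAlong, norm_mul, mul_pow, norm_prod,
    Finset.prod_pow]

/-- Tracing out a part of a product state multiplies by its squared norm. -/
theorem reduced_tensorAlong (hf : f.Injective) {O : Type*} (o : O → L) (Φ : QState L)
    (q : W → ZMod 2 → ℂ) :
    reduced (f ∘ o) (tensorAlong f Φ q) =
      ((∏ w ∈ (Finset.univ.image f)ᶜ, qubitWeight (q w) : ℝ) : ℂ) • reduced o Φ := by
  classical
  set C := (Finset.univ.image f)ᶜ with hC
  funext z z'
  -- Agreement off the range of `f ∘ o` is agreement off the range of `o`, together with agreement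
  -- at each qubit off the range of `f`; the latter is a product of conditions on single qubits.
  have hcond : ∀ u v : W → ZMod 2,
      (u ∘ (f ∘ o) = z ∧ v ∘ (f ∘ o) = z' ∧ ∀ w ∉ Set.range (f ∘ o), u w = v w) ↔
        ((u ∘ f) ∘ o = z ∧ (v ∘ f) ∘ o = z' ∧ ∀ l ∉ Set.range o, (u ∘ f) l = (v ∘ f) l) ∧
          ∀ w ∈ C, u w = v w := by
    intro u v
    constructor
    · rintro ⟨h1, h2, h3⟩
      refine ⟨⟨h1, h2, fun l hl => h3 _ ?_⟩, fun w hw => h3 _ ?_⟩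
      · rintro ⟨a, ha⟩
        exact hl ⟨a, hf ha⟩
      · rintro ⟨a, rfl⟩
        exact notMem_compl_image f _ hw
    · rintro ⟨⟨h1, h2, h3⟩, h4⟩
      refine ⟨h1, h2, fun w hw => ?_⟩
      by_cases hwC : w ∈ C
      · exact h4 w hwC
      · rw [hC, Finset.mem_compl, not_not, Finset.mem_image] at hwC
        obtain ⟨l, -, rfl⟩ := hwC
        refine h3 l ?_
        rintro ⟨a, rfl⟩
        exact hw ⟨a, rfl⟩
  let G : (L → ZMod 2) → (L → ZMod 2) → ℂ := fun a b =>
    if a ∘ o = z ∧ b ∘ o = z' ∧ ∀ l ∉ Set.range o, a l = b l then Φ a * conj (Φ b) else 0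
  have hterm : ∀ u v : W → ZMod 2,
      (if u ∘ (f ∘ o) = z ∧ v ∘ (f ∘ o) = z' ∧ ∀ w ∉ Set.range (f ∘ o), u w = v w then
        tensorAlong f Φ q u * conj (tensorAlong f Φ q v) else 0) =
      G (u ∘ f) (v ∘ f) * ∏ w ∈ C, if u w = v w then q w (u w) * conj (q w (v w)) else 0 := by
    intro u v
    by_cases h4 : ∀ w ∈ C, u w = v w
    · rw [Finset.prod_congr rfl fun w hw => if_pos (h4 w hw), Finset.prod_mul_distrib,
        ite_mul, zero_mul]
      refine if_congr ((hcond u v).trans (and_iff_left h4)) ?_ rfl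
      simp only [tensorAlong, map_mul, map_prod, ← hC]
      ring
    · rw [if_neg fun h => h4 ((hcond u v).1 h).2]
      push Not at h4
      obtain ⟨w, hw, hne⟩ := h4
      rw [Finset.prod_eq_zero hw (if_neg hne), mul_zero]
  have hin : ∀ u : W → ZMod 2,
      ∑ v : W → ZMod 2,
        G (u ∘ f) (v ∘ f) * ∏ w ∈ C, (if u w = v w then q w (u w) * conj (q w (v w)) else 0) =
      (∑ b, G (u ∘ f) b) * ∏ w ∈ C, ((‖q w (u w)‖ ^ 2 : ℝ) : ℂ) := by
    intro u
    rw [sum_comp_mul_prod hf (fun b => G (u ∘ f) b)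
      fun w y => if u w = y then q w (u w) * conj (q w y) else 0]
    refine congrArg _ (Finset.prod_congr rfl fun w _ => ?_)
    rw [Finset.sum_ite_eq, if_pos (Finset.mem_univ _), Complex.mul_conj,
      Complex.normSq_eq_norm_sq]
  calc reduced (f ∘ o) (tensorAlong f Φ q) z z'
      = ∑ u : W → ZMod 2, ∑ v : W → ZMod 2, G (u ∘ f) (v ∘ f) *
          ∏ w ∈ C, (if u w = v w then q w (u w) * conj (q w (v w)) else 0) :=
        Finset.sum_congr rfl fun u _ => Finset.sum_congr rfl fun v _ => by
          rw [← hterm]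
    _ = (∑ a, ∑ b, G a b) * ∏ w ∈ C, ∑ y, ((‖q w y‖ ^ 2 : ℝ) : ℂ) := by
        rw [Finset.sum_congr rfl fun u _ => hin u]
        exact sum_comp_mul_prod hf (fun a => ∑ b, G a b) fun w y => ((‖q w y‖ ^ 2 : ℝ) : ℂ)
    _ = _ := by
        rw [mul_comm, Matrix.smul_apply, smul_eq_mul, Complex.ofReal_prod]
        simp only [qubitWeight, Complex.ofReal_sum]
        rfl

theorem project_tensorAlong (hf : f.Injective) (l : L) (δ : ZMod 8) (b : ZMod 2)
    (Φ : QState L) (q : W → ZMod 2 → ℂ) :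
    project (f l) δ b (tensorAlong f Φ q) = tensorAlong f (project l δ b Φ) q := by
  funext z
  simp only [project, tensorAlong, Function.update_comp_eq_of_injective z hf, Function.comp_apply]
  rw [mul_assoc, Finset.sum_mul]
  refine congrArg _ (Finset.sum_congr rfl fun y _ => ?_)
  rw [mul_assoc]
  congr 2
  refine Finset.prod_congr rfl fun w hw => ?_
  rw [Function.update_of_ne]
  rintro rfl
  exact notMem_compl_image f l hw

end TensorAlong

/-! ### Controlled-`Z` gates on a dotted graph -/

section Entangle

variable {V : Type*} [Fintype V] [DecidableEq V] (H : SimpleGraph V) [DecidableRel H.Adj]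

/-- The parity of the number of edges of `D(H)` whose endpoints both carry a `1`; the edges of
`D(H)` are the pairs of a vertex of `H` and an edge of `H` at it. -/
def edgeParity (z : DottedVertex H → ZMod 2) : ZMod 2 :=
  ∑ v : V, ∑ e : H.edgeSet, if v ∈ e.1 then z (.inl v) * z (.inr e) else 0

theorem natCast_card_edges_eq_edgeParity (z : DottedVertex H → ZMod 2) :
    (((dotted H).edgeFinset.filter fun e => ∀ w ∈ e, z w = 1).card : ZMod 2) = edgeParity H z := by
  have hcard : ((dotted H).edgeFinset.filter fun e => ∀ w ∈ e, z w = 1).card =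
      (Finset.univ.filter fun p : V × H.edgeSet =>
        p.1 ∈ p.2.1 ∧ z (.inl p.1) = 1 ∧ z (.inr p.2) = 1).card := by
    symm
    refine Finset.card_bij (fun p _ => s(.inl p.1, .inr p.2)) ?_ ?_ ?_
    · rintro ⟨v, e⟩ h
      obtain ⟨-, hv, h1, h2⟩ := Finset.mem_filter.1 h
      refine Finset.mem_filter.2 ⟨SimpleGraph.mem_edgeFinset.2 hv, fun w hw => ?_⟩
      rcases Sym2.mem_iff.1 hw with rfl | rfl <;> assumption
    · rintro ⟨v, e⟩ - ⟨v', e'⟩ - h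
      rcases Sym2.eq_iff.1 h with ⟨h1, h2⟩ | ⟨h1, h2⟩
      · exact Prod.ext (Sum.inl_injective h1) (Sum.inr_injective h2)
      · cases h1
    · intro s hs
      induction s using Sym2.ind with | _ a b => ?_
      obtain ⟨hs, h1⟩ := Finset.mem_filter.1 hs
      have ha := h1 a (Sym2.mem_mk_left _ _)
      have hb := h1 b (Sym2.mem_mk_right _ _)
      have hab : DottedAdj H a b := SimpleGraph.mem_edgeFinset.1 hs
      rcases a with v | e <;> rcases b with w | f
      · exact hab.elim
      · exact ⟨(v, f), Finset.mem_filter.2 ⟨Finset.mem_univ _, hab, ha, hb⟩, rfl⟩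
      · exact ⟨(w, e), Finset.mem_filter.2 ⟨Finset.mem_univ _, hab, hb, ha⟩, Sym2.eq_swap⟩
      · exact hab.elim
  have hmul : ∀ a b : ZMod 2, (if a = 1 ∧ b = 1 then 1 else 0) = a * b := by decide
  rw [hcard, Finset.natCast_card_filter, Fintype.sum_prod_type]
  refine Finset.sum_congr rfl fun v _ => Finset.sum_congr rfl fun e _ => ?_
  rw [ite_and, hmul]

theorem entangle_dotted_apply (Ψ : QState (DottedVertex H)) (z : DottedVertex H → ZMod 2) :
    entangle (dotted H) Ψ z = phase (bitPi (edgeParity H z)) * Ψ z := by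
  rw [entangle, neg_one_pow_eq_phase, natCast_card_edges_eq_edgeParity]

theorem sum_neighbours_inl (x : DottedVertex H → ZMod 2) (v : V) :
    ∑ u with (dotted H).Adj (.inl v) u, x u = ∑ e : H.edgeSet, if v ∈ e.1 then x (.inr e) else 0 := by
  rw [Finset.sum_filter, Fintype.sum_sum_type]
  refine (congrArg₂ _ (Finset.sum_eq_zero fun w _ => if_neg id) rfl).trans ((zero_add _).trans ?_)
  exact Finset.sum_congr rfl fun e _ => if_congr Iff.rfl rfl rfl

theorem sum_neighbours_inr (x : DottedVertex H → ZMod 2) (e : H.edgeSet) :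
    ∑ u with (dotted H).Adj (.inr e) u, x u = ∑ v, if v ∈ e.1 then x (.inl v) else 0 := by
  rw [Finset.sum_filter, Fintype.sum_sum_type]
  refine (congrArg₂ _ rfl (Finset.sum_eq_zero fun w _ => if_neg id)).trans ((add_zero _).trans ?_)
  exact Finset.sum_congr rfl fun v _ => if_congr Iff.rfl rfl rfl

/-- The edge parity is a quadratic form. Its polar form is what turns an `X` before the
controlled-`Z` gates into `Z`s on the neighbours after them. -/
theorem edgeParity_add (z x : DottedVertex H → ZMod 2) :
    edgeParity H (z + x) = edgeParity H z + edgeParity H x +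
      ∑ w, z w * ∑ u with (dotted H).Adj w u, x u := by
  rw [Fintype.sum_sum_type]
  simp only [sum_neighbours_inl, sum_neighbours_inr, Finset.mul_sum, edgeParity]
  rw [Finset.sum_comm (s := (Finset.univ : Finset H.edgeSet))]
  simp only [← Finset.sum_add_distrib]
  refine Finset.sum_congr rfl fun v _ => Finset.sum_congr rfl fun e _ => ?_
  split_ifs
  · simp only [Pi.add_apply]
    ring
  · simp

end Entangle

/-! ### The state after the entangling step -/

section Protocol

variable {V : Type*} {G : SimpleGraph V}

theorem TrapColouring.IsDummy.not_green {κ : TrapColouring G} {l : DottedVertex G}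
    (h : κ.IsDummy (κ.greenVertex l)) : False :=
  h.colour_ne (κ.colour_greenVertex l)

variable [DecidableEq V] {α : Type*}

namespace Secrets

variable {M : MeasurementPattern (DottedVertex G) α} (ν : Secrets M)

theorem isInput_greenVertex (l : DottedVertex G) :
    ν.IsInput (ν.colouring.greenVertex l) ↔ l ∈ M.input := by
  rw [IsInput, ν.colouring.baseLocation_greenVertex]
  exact and_iff_right (ν.colouring.colour_greenVertex l)

theorem isOutput_greenVertex (l : DottedVertex G) :
    ν.IsOutput (ν.colouring.greenVertex l) ↔ l ∈ M.output := by
  rw [IsOutput, ν.colouring.baseLocation_greenVertex]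
  exact and_iff_right (ν.colouring.colour_greenVertex l)

/-- The bit flips of the encryption, as a function of the qubits of the pattern. -/
def flip (l : DottedVertex G) : ZMod 2 := if l ∈ M.input then ν.x l else 0

theorem inputFlip_greenVertex (l : DottedVertex G) :
    ν.inputFlip (ν.colouring.greenVertex l) = ν.flip l := by
  rw [inputFlip, flip, ν.colouring.baseLocation_greenVertex]
  exact if_congr (ν.isInput_greenVertex l) rfl rfl

/-- The single-qubit states of the traps and the dummies. -/
noncomputable def separated (w : DTVertex G) : ZMod 2 → ℂ :=
  if ν.colouring.IsDummy w then fun z => if z = ν.d w then 1 else 0 else plusKet (ν.θ w)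

theorem qubitWeight_separated (w : DTVertex G) : qubitWeight (ν.separated w) = 1 := by
  unfold separated
  split_ifs
  · exact qubitWeight_basis _
  · exact qubitWeight_plusKet _

end Secrets

variable [Fintype V] [DecidableRel G.Adj]

theorem TrapColouring.mem_compl_green (κ : TrapColouring G) {w : DTVertex G} :
    w ∈ (Finset.univ.image κ.greenVertex)ᶜ ↔ κ.colour w ≠ .green := by
  rw [Finset.mem_compl, not_iff_not, Finset.mem_image]
  refine ⟨?_, fun h => ⟨_, Finset.mem_univ _, κ.greenVertex_baseLocation h⟩⟩
  rintro ⟨l, -, rfl⟩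
  exact κ.colour_greenVertex l

theorem MeasurementPattern.start_eq_tensorAlong {L : Type*} [Fintype L] [DecidableEq L]
    (M : MeasurementPattern L α) (ψ : QState M.input) :
    M.start ψ = tensorAlong Subtype.val ψ fun _ => plusKet 0 := by
  funext z
  simp only [MeasurementPattern.start, tensorAlong]
  congr 2
  ext i
  simp

namespace Secrets

variable {M : MeasurementPattern (DottedVertex G) α} (ν : Secrets M)

theorem inputFlipSum_greenVertex (l : DottedVertex G) :
    ν.inputFlipSum (ν.colouring.greenVertex l) = ∑ u with (dotted G).Adj l u, ν.flip u := by
  rw [inputFlipSum, Finset.sum_filter, Finset.sum_filter]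
  refine (Fintype.sum_of_injective _ ν.colouring.greenVertex_injective _ _ ?_ ?_).symm
  · intro w hw
    have hin : ¬ ν.IsInput w := fun h => hw ⟨_, ν.colouring.greenVertex_baseLocation h.1⟩
    rw [inputFlip, if_neg hin, ite_self]
  · intro u
    rw [ν.inputFlip_greenVertex]
    exact if_congr ν.colouring.adj_greenVertex.symm rfl rfl

theorem brokenState_eq_tensorAlong (ψ : QState M.input) :
    ν.brokenState ψ = tensorAlong ν.colouring.greenVertex (ν.greenState ψ) ν.separated := by
  funext z
  have hsplit : (Finset.univ.image ν.colouring.greenVertex)ᶜ =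
      (Finset.univ.filter fun t => ν.colouring.IsTrap t) ∪
        Finset.univ.filter fun w => ν.colouring.IsDummy w := by
    ext w
    rw [ν.colouring.mem_compl_green]
    have := ν.colouring.green_or_trap_or_dummy w
    simp only [Finset.mem_union, Finset.mem_filter, Finset.mem_univ, true_and]
    tauto
  have hdisj : Disjoint (Finset.univ.filter fun t => ν.colouring.IsTrap t)
      (Finset.univ.filter fun w => ν.colouring.IsDummy w) :=
    Finset.disjoint_filter.2 fun w _ ht => ht.not_isDummy
  rw [brokenState, tensorAlong, hsplit, Finset.prod_union hdisj, mul_assoc]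
  congr 2
  · refine Finset.prod_congr rfl fun t ht => ?_
    rw [separated, if_neg (Finset.mem_filter.1 ht).2.not_isDummy]
  · refine Finset.prod_congr rfl fun w hw => ?_
    rw [separated, if_pos (Finset.mem_filter.1 hw).2]

/-- The encrypted input. -/
noncomputable def encryptedInput (ψ : QState M.input) : QState M.input :=
  powX (fun i : M.input => ν.x i) (rotZ (fun i : M.input => ν.θ (ν.colouring.greenVertex i)) ψ)

theorem sent_eq_tensorAlong (ψ : QState M.input) :
    ν.sent ψ = tensorAlong ν.colouring.greenVertex
      (tensorAlong Subtype.val (ν.encryptedInput ψ) fun l =>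
        ν.sentQubit (ν.colouring.greenVertex l)) ν.sentQubit := by
  funext z
  have hin : (Finset.univ.image (Subtype.val : M.input → DottedVertex G))ᶜ = M.inputᶜ := by
    ext
    simp
  simp only [sent, tensorAlong, hin]
  rw [mul_assoc]
  congr 1
  rw [Finset.prod_filter, ← Finset.prod_mul_prod_compl (Finset.univ.image ν.colouring.greenVertex),
    Finset.prod_image ν.colouring.greenVertex_injective.injOn]
  congr 1
  · rw [← Finset.prod_subset (Finset.subset_univ M.inputᶜ)]
    · refine Finset.prod_congr rfl fun l hl => if_pos ?_
      rwa [ν.isInput_greenVertex, ← Finset.mem_compl]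
    · intro l _ hl
      rw [Finset.mem_compl, not_not] at hl
      exact if_neg (not_not.2 ((ν.isInput_greenVertex l).2 hl))
  · refine Finset.prod_congr rfl fun w hw => if_pos fun h => ?_
    exact ν.colouring.mem_compl_green.1 hw h.1

theorem greenState_eq_entangle (ψ : QState M.input) :
    ν.greenState ψ = entangle (dotted G) (tensorAlong Subtype.val
      (rotZ (fun i : M.input => bitPi (ν.dummySum (ν.colouring.greenVertex i)))
        (ν.encryptedInput ψ)) fun l => plusKet (ν.θ (ν.colouring.greenVertex l))) := by
  have hmem : ∀ l ∈ (Finset.univ.image (Subtype.val : M.input → DottedVertex G))ᶜ,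
      l ∉ M.input := by simp
  rw [greenState, M.start_eq_tensorAlong, rotZ_tensorAlong Subtype.val_injective,
    powX_tensorAlong_of_support fun l hl => if_neg (hmem l hl),
    rotZ_tensorAlong_of_support Subtype.val_injective fun l hl => if_neg (hmem l hl)]
  congr 1
  have hx : (fun l => if l ∈ M.input then ν.x l else 0) ∘ (Subtype.val : M.input → _) =
      fun i : M.input => ν.x i := funext fun i => if_pos i.2
  have hd : (fun l => if l ∈ M.input then bitPi (ν.dummySum (ν.colouring.greenVertex l)) else 0) ∘
      (Subtype.val : M.input → _) =
      fun i : M.input => bitPi (ν.dummySum (ν.colouring.greenVertex i)) :=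
    funext fun i => if_pos i.2
  rw [hx, hd]
  refine tensorAlong_congr _ fun l _ => funext fun y => ?_
  rcases zmod_two_cases y with rfl | rfl <;> simp [plusKet, phase_zero, div_eq_mul_inv]

/-- Among the vertices that are not dummies, the only edges are those of the green `D(G)`. -/
theorem edgeParity_eq_green {y : DTVertex G → ZMod 2} (hy : ∀ w, ν.colouring.IsDummy w → y w = 0) :
    edgeParity (tripleGraph G) y = edgeParity G (y ∘ ν.colouring.greenVertex) := by
  have hgreen : ∀ {p : V × Fin 3} {e : (tripleGraph G).edgeSet}, p ∈ e.1 →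
      y (.inl p) * y (.inr e) ≠ 0 →
        ν.colouring.colour (.inl p) = .green ∧ ν.colouring.colour (.inr e) = .green := by
    intro p e hpe h
    have hp : ¬ ν.colouring.IsDummy (.inl p) := fun hd => h (by rw [hy _ hd, zero_mul])
    have he : ¬ ν.colouring.IsDummy (.inr e) := fun hd => h (by rw [hy _ hd, mul_zero])
    have hp' : ¬ ν.colouring.IsTrap (.inl p) := fun ht =>
      ν.colouring.not_adj_of_isTrap ht he hpe
    have he' : ¬ ν.colouring.IsTrap (.inr e) := fun ht =>
      ν.colouring.not_adj_of_isTrap ht hp hpe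
    have h1 := ν.colouring.green_or_trap_or_dummy (.inl p)
    have h2 := ν.colouring.green_or_trap_or_dummy (.inr e)
    tauto
  symm
  refine Fintype.sum_of_injective ν.colouring.greenHom ν.colouring.greenHom_injective _ _ ?_ ?_
  · intro p hp
    refine Finset.sum_eq_zero fun e _ => ite_eq_right_iff.2 fun hpe => ?_
    by_contra h
    exact hp ⟨p.1, Sum.inl_injective (ν.colouring.greenVertex_baseLocation (hgreen hpe h).1)⟩
  · intro v
    refine Fintype.sum_of_injective (ν.colouring.greenHom.mapEdgeSet)
      (fun e f h => Sum.inr_injective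
        (ν.colouring.greenVertex_injective (congrArg Sum.inr h))) _ _ ?_ ?_
    · intro e he
      refine ite_eq_right_iff.2 fun hve => ?_
      by_contra h
      exact he ⟨(tripleProj G).mapEdgeSet e,
        Sum.inr_injective (ν.colouring.greenVertex_baseLocation (hgreen hve h).2)⟩
    · intro e
      exact if_congr (ν.colouring.adj_greenVertex (l := .inl v) (l' := .inr e)).symm rfl rfl

theorem sentQubit_eq {w : DTVertex G} (hw : ¬ ν.colouring.IsDummy w) (z : ZMod 2) :
    ν.sentQubit w z = phase (bitPi (z * ν.dummySum w)) * plusKet (ν.θ w) z := by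
  rw [sentQubit, if_neg hw]
  rcases zmod_two_cases z with rfl | rfl <;> simp [bitPi_zero, phase_zero]

/-- The controlled-`Z` gates at a dummy in state `|1⟩` act as `Z` on its neighbours. The preparation
compensates this except at the input qubits, and what is left are the gates within the green
`D(G)` and a sign from the edges between dummies. -/
theorem exists_entangled_eq_brokenState (ψ : QState M.input) :
    ∃ c : ℂ, ‖c‖ = 1 ∧ ν.entangled ψ = c • ν.brokenState ψ := by
  let g := ν.colouring.greenVertex
  let zd : DTVertex G → ZMod 2 := fun w => if ν.colouring.IsDummy w then ν.d w else 0
  refine ⟨phase (bitPi (edgeParity (tripleGraph G) zd)), norm_phase _, ?_⟩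
  rw [brokenState_eq_tensorAlong, entangled, sent_eq_tensorAlong, greenState_eq_entangle]
  funext z
  rw [Pi.smul_apply, smul_eq_mul, entangle_dotted_apply]
  by_cases hz : ∀ w, ν.colouring.IsDummy w → z w = ν.d w
  swap
  · push Not at hz
    obtain ⟨w, hw, hne⟩ := hz
    have hmem := ν.colouring.mem_compl_green.2 hw.colour_ne
    have hzero : ∀ Φ q, q w (z w) = 0 → tensorAlong ν.colouring.greenVertex Φ q z = 0 :=
      fun Φ q hq => mul_eq_zero_of_right _ (Finset.prod_eq_zero hmem hq)
    rw [hzero _ ν.sentQubit (by rw [sentQubit, if_pos hw, if_neg hne]),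
      hzero _ ν.separated (by rw [separated, if_pos hw, if_neg hne]), mul_zero, mul_zero]
  -- Split the assignment into the part off the dummies and the fixed bits of the dummies: the polar
  -- form of the edge parity collects the signs between the two.
  let zn : DTVertex G → ZMod 2 := fun w => if ν.colouring.IsDummy w then 0 else z w
  have hzsum : z = zn + zd := by
    funext w
    by_cases hw : ν.colouring.IsDummy w
    · simp [zn, zd, hw, hz w hw]
    · simp [zn, zd, hw]
  have hzg : ∀ l, zn (g l) = z (g l) := fun l => if_neg fun h => h.not_green
  have hdummy : ∀ w, ∑ u with (dottedTriple G).Adj w u, zd u = ν.dummySum w := by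
    intro w
    rw [dummySum, ← Finset.filter_filter, Finset.sum_filter (p := ν.colouring.IsDummy)]
  have hpar : edgeParity (tripleGraph G) z = edgeParity G (z ∘ g) +
      edgeParity (tripleGraph G) zd + ∑ w, zn w * ν.dummySum w := by
    conv_lhs => rw [hzsum]
    rw [edgeParity_add, ν.edgeParity_eq_green fun w hw => if_pos hw]
    simp only [hdummy]
    congr 3
    exact funext hzg
  let c : DTVertex G → ZMod 8 := fun w => bitPi (zn w * ν.dummySum w)
  have hsep : ∏ w ∈ (Finset.univ.image g)ᶜ, ν.sentQubit w (z w) =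
      phase (∑ w ∈ (Finset.univ.image g)ᶜ, c w) *
        ∏ w ∈ (Finset.univ.image g)ᶜ, ν.separated w (z w) := by
    rw [phase_sum, ← Finset.prod_mul_distrib]
    refine Finset.prod_congr rfl fun w _ => ?_
    by_cases hw : ν.colouring.IsDummy w
    · simp [c, zn, hw, sentQubit, separated, bitPi_zero, phase_zero]
    · simp only [c, zn, separated, if_neg hw, ν.sentQubit_eq hw]
  have hgreen : ∏ l ∈ (Finset.univ.image (Subtype.val : M.input → DottedVertex G))ᶜ,
        ν.sentQubit (g l) ((z ∘ g) l) =
      phase (∑ l ∈ (Finset.univ.image (Subtype.val : M.input → DottedVertex G))ᶜ, c (g l)) *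
        ∏ l ∈ (Finset.univ.image (Subtype.val : M.input → DottedVertex G))ᶜ,
          plusKet (ν.θ (g l)) ((z ∘ g) l) := by
    rw [phase_sum, ← Finset.prod_mul_distrib]
    refine Finset.prod_congr rfl fun l _ => ?_
    rw [ν.sentQubit_eq fun h => h.not_green]
    simp only [c, hzg, Function.comp_apply, g]
  have hsum : bitPi (∑ w, zn w * ν.dummySum w) = (∑ i : M.input, c (g i)) +
      (∑ l ∈ (Finset.univ.image (Subtype.val : M.input → DottedVertex G))ᶜ, c (g l)) +
      ∑ w ∈ (Finset.univ.image g)ᶜ, c w := by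
    rw [bitPi_sum, ← Finset.sum_add_sum_compl (Finset.univ.image g),
      Finset.sum_image ν.colouring.greenVertex_injective.injOn,
      ← Finset.sum_add_sum_compl (Finset.univ.image (Subtype.val : M.input → DottedVertex G)),
      Finset.sum_image Subtype.val_injective.injOn]
  have hrot : (∑ i : M.input, if ((z ∘ g) ∘ Subtype.val) i = 0 then 0 else
      bitPi (ν.dummySum (g i))) = ∑ i : M.input, c (g i) := by
    refine Finset.sum_congr rfl fun i _ => ?_
    simp only [c, hzg, Function.comp_apply]
    rcases zmod_two_cases (z (g i)) with h | h <;> simp [h, bitPi_zero]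
  -- The signs at the non-input qubits and the traps occur twice, in the gates and in the preparation.
  have hcsq : ∀ w, c w + c w = 0 := fun w => by
    rw [← bitPi_add, CharTwo.add_self_eq_zero, bitPi_zero]
  have htwice : ∀ {ι : Type _} (s : Finset ι) (h : ι → DTVertex G),
      phase (∑ i ∈ s, c (h i)) * phase (∑ i ∈ s, c (h i)) = 1 := by
    intro ι s h
    rw [← phase_add, ← Finset.sum_add_distrib, Finset.sum_eq_zero fun i _ => hcsq _, phase_zero]
  have h1 := htwice (Finset.univ.image (Subtype.val : M.input → DottedVertex G))ᶜ g
  have h2 := htwice (Finset.univ.image g)ᶜ id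
  simp only [id] at h2
  simp only [tensorAlong, entangle_dotted_apply, rotZ_apply]
  rw [hsep, hgreen, hrot, hpar, bitPi_add, bitPi_add, hsum, phase_add, phase_add, phase_add,
    phase_add]
  generalize phase (∑ l ∈ (Finset.univ.image (Subtype.val : M.input → DottedVertex G))ᶜ,
    c (g l)) = A at h1 ⊢
  generalize phase (∑ w ∈ (Finset.univ.image g)ᶜ, c w) = B at h2 ⊢
  change _ * _ * (_ * _ * B) * ((ν.encryptedInput ψ ((z ∘ g) ∘ Subtype.val) * (A * _)) * (B * _)) =
    _
  linear_combination (phase (bitPi (edgeParity G (z ∘ g))) *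
    phase (bitPi (edgeParity (tripleGraph G) zd)) * phase (∑ i : M.input, c (g i)) *
    ν.encryptedInput ψ ((z ∘ g) ∘ Subtype.val) *
    (∏ l ∈ (Finset.univ.image (Subtype.val : M.input → DottedVertex G))ᶜ,
          plusKet (ν.θ (g l)) ((z ∘ g) l)) *
    ∏ w ∈ (Finset.univ.image g)ᶜ, ν.separated w (z w)) * (B * B * h1 + h2)

/-- The encryption of the qubits of the pattern: `⨂ X ^ x Z(key)`. -/
noncomputable def encrypt (Φ : QState (DottedVertex G)) : QState (DottedVertex G) :=
  powX ν.flip (rotZ (fun l => ν.key (ν.colouring.greenVertex l)) Φ)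

/-- Moving the bit flips behind the controlled-`Z` gates leaves a `Z` for every flipped
neighbour, as accounted for by `key`. -/
theorem exists_greenState_eq_encrypt (ψ : QState M.input) :
    ∃ c : ℂ, ‖c‖ = 1 ∧
      ν.greenState ψ = c • ν.encrypt (entangle (dotted G) (M.start ψ)) := by
  let g := ν.colouring.greenVertex
  let x := ν.flip
  let S : DottedVertex G → ZMod 2 := fun l => ∑ u with (dotted G).Adj l u, x u
  let D : DottedVertex G → ZMod 2 := fun l => if l ∈ M.input then ν.dummySum (g l) else 0
  have hkey : ∀ l, ν.key (g l) = ν.θ (g l) + bitPi (S l + D l) := by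
    intro l
    rw [key, bitPi_add, add_assoc, ν.inputFlipSum_greenVertex]
    congr 2
    by_cases hl : l ∈ M.input
    · rw [if_pos ((ν.isInput_greenVertex l).2 hl), show D l = ν.dummySum (g l) from if_pos hl]
    · rw [if_neg (mt (ν.isInput_greenVertex l).1 hl), show D l = 0 from if_neg hl, bitPi_zero]
  have hbit : ∀ z t : ZMod 2, (if z = 0 then 0 else bitPi t) = bitPi (z * t) := by decide
  refine ⟨phase (bitPi (edgeParity G x + ∑ l, x l * (S l + D l))), norm_phase _, ?_⟩
  funext z
  have hD : (∑ l, if z l = 0 then 0 else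
      if l ∈ M.input then bitPi (ν.dummySum (g l)) else 0) = bitPi (∑ l, z l * D l) := by
    rw [bitPi_sum]
    refine Finset.sum_congr rfl fun l _ => ?_
    rw [← hbit]
    congr 1
    by_cases hl : l ∈ M.input <;> simp [D, hl, bitPi_zero]
  have hK : (∑ l, if (z + x) l = 0 then 0 else ν.key (g l)) =
      (∑ l, if (z + x) l = 0 then 0 else ν.θ (g l)) + bitPi (∑ l, (z + x) l * (S l + D l)) := by
    rw [bitPi_sum, ← Finset.sum_add_distrib]
    refine Finset.sum_congr rfl fun l _ => ?_
    rw [hkey, ← hbit]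
    split_ifs
    · exact (add_zero 0).symm
    · rfl
  have hparity : edgeParity G z + ∑ l, z l * D l =
      edgeParity G x + ∑ l, x l * (S l + D l) +
        (∑ l, (z + x) l * (S l + D l) + edgeParity G (z + x)) := by
    have htwo : (2 : ZMod 2) = 0 := rfl
    rw [edgeParity_add]
    simp only [Pi.add_apply, add_mul, mul_add, Finset.sum_add_distrib]
    linear_combination (-(edgeParity G x) - ∑ l, x l * S l - ∑ l, x l * D l -
      ∑ l, z l * S l) * htwo
  rw [Pi.smul_apply, smul_eq_mul, greenState, encrypt, entangle_dotted_apply, rotZ_apply, hD]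
  simp only [powX, rotZ_apply, entangle_dotted_apply]
  change _ * (_ * (phase (∑ l, if (z + x) l = 0 then 0 else ν.θ (g l)) * M.start ψ (z + x))) =
    _ * (phase (∑ l, if (z + x) l = 0 then 0 else ν.key (g l)) *
      (phase (bitPi (edgeParity G (z + x))) * M.start ψ (z + x)))
  have hp := congrArg (fun t => phase (bitPi t)) hparity
  simp only [bitPi_add, phase_add] at hp
  rw [hK, phase_add, bitPi_add, phase_add]
  linear_combination (phase (∑ l, if (z + x) l = 0 then 0 else ν.θ (g l)) *
    M.start ψ (z + x)) * hp

end Secrets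

end Protocol

/-! ### Branches of a sequence of measurements -/

section Branches

variable {W : Type*} [DecidableEq W] {δ : W → (W → ZMod 2) → ZMod 8} {r : W → ZMod 2}

theorem sum_map_branches_cons {A : Type*} [AddCommMonoid A] (F : Branch W → A) (i : W)
    (l : List W) (c : Branch W) :
    ((branches δ r (i :: l) c).map F).sum =
      ∑ β, ((branches δ r l (measureStep δ r i β c)).map F).sum := by
  rw [sum_zmod_two, branches, List.map_append, List.sum_append]

theorem sum_map_filter_eq {B A : Type*} [AddCommMonoid A] (p : B → Prop) [DecidablePred p]
    (F : B → A) (l : List B) :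
    ((l.filter fun c => p c).map F).sum = (l.map fun c => if p c then F c else 0).sum := by
  induction l with
  | nil => rfl
  | cons c l ih =>
    by_cases hc : p c
    · simp [hc, ih]
    · simp [hc, ih]

theorem sum_weight_branches [Fintype W] (l : List W) (c : Branch W) :
    ((branches δ r l c).map fun c => weight c.state).sum = weight c.state := by
  induction l generalizing c with
  | nil => simp [branches]
  | cons i l ih => rw [sum_map_branches_cons, sum_zmod_two, ih, ih, measureStep, measureStep,
      weight_project]

theorem state_eq_zero_of_mem_branches {l : List W} {c c' : Branch W} (hc : c.state = 0)
    (h : c' ∈ branches δ r l c) : c'.state = 0 := by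
  induction l generalizing c with
  | nil => rw [branches, List.mem_singleton] at h; rw [h, hc]
  | cons i l ih =>
    have hstep : ∀ β, (measureStep δ r i β c).state = 0 := fun β => by
      rw [measureStep, hc, project_zero]
    rcases List.mem_append.1 h with h | h
    · exact ih (hstep 0) h
    · exact ih (hstep 1) h

theorem outcome_eq_of_notMem {l : List W} {c c' : Branch W} {t : W} (ht : t ∉ l)
    (h : c' ∈ branches δ r l c) : c'.b t = c.b t := by
  induction l generalizing c with
  | nil => rw [branches, List.mem_singleton] at h; rw [h]
  | cons i l ih =>
    have hstep : ∀ β, (measureStep δ r i β c).b t = c.b t := fun β =>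
      Function.update_of_ne (List.ne_of_not_mem_cons ht) _ _
    rcases List.mem_append.1 h with h | h
    · exact (ih (List.not_mem_of_not_mem_cons ht) h).trans (hstep 0)
    · exact (ih (List.not_mem_of_not_mem_cons ht) h).trans (hstep 1)

/-- A qubit in state `|+_θ⟩`, in tensor product with the others, returns the outcome `r` when it is
measured with angle `θ + r π`. That the qubit is in this state is expressed by the vanishing of the
component with the opposite outcome, which measurements of other qubits preserve. -/
theorem outcome_eq_of_project_eq_zero {t : W} {θ : ZMod 8} (hδ : ∀ s, δ t s = θ + bitPi (r t))
    {l : List W} (hl : l.Nodup) (ht : t ∈ l) {c c' : Branch W} (hc : project t θ 1 c.state = 0)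
    (h : c' ∈ branches δ r l c) (h0 : c'.state ≠ 0) : c'.b t = r t := by
  induction l generalizing c with
  | nil => cases ht
  | cons i l ih =>
    obtain ⟨hil, hl⟩ := List.nodup_cons.1 hl
    obtain ⟨β, hβ⟩ : ∃ β, c' ∈ branches δ r l (measureStep δ r i β c) := by
      rcases List.mem_append.1 h with h | h
      · exact ⟨0, h⟩
      · exact ⟨1, h⟩
    rcases eq_or_ne i t with rfl | hit
    · have hb : c'.b i = β := (outcome_eq_of_notMem hil hβ).trans (Function.update_self _ _ _)
      rw [hb]
      by_contra hne
      refine h0 (state_eq_zero_of_mem_branches ?_ hβ)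
      have hsum : ∀ a b : ZMod 2, a ≠ b → a + b = 1 := by decide
      rw [measureStep, hδ, project_add_bitPi, hsum _ _ hne, hc]
    · refine ih hl ((List.mem_cons.1 ht).resolve_left hit.symm) ?_ hβ
      rw [measureStep, project_comm hit.symm, hc, project_zero]

end Branches

theorem qubitProject_plusKet (θ : ZMod 8) : qubitProject θ 1 (plusKet θ) = 0 := by
  have h : ∑ y, conj (plusKet (θ + bitPi 1) y) * plusKet θ y = 0 := by
    have hθ : conj (phase θ) * phase θ = 1 := by rw [mul_comm, phase_mul_conj_self]
    rw [sum_zmod_two, show bitPi 1 = 4 from rfl]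
    simp only [plusKet, if_true, one_ne_zero, if_false, phase_add, phase_four, map_div₀, map_mul,
      map_neg, map_one, Complex.conj_ofReal]
    rw [div_mul_div_comm, div_mul_div_comm, ← add_div]
    simp [hθ]
  funext z
  rw [qubitProject, h, mul_zero, Pi.zero_apply]

section Protocol

variable {V : Type*} [Fintype V] [DecidableEq V] {G : SimpleGraph V} [DecidableRel G.Adj]
  {α : Type*}

namespace Secrets

variable {M : MeasurementPattern (DottedVertex G) α} (ν : Secrets M)

/-! ### The traps -/

theorem weight_entangled (ψ : QState M.input) : weight (ν.entangled ψ) = weight ψ := by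
  obtain ⟨c, hc, h⟩ := ν.exists_entangled_eq_brokenState ψ
  obtain ⟨c', hc', h'⟩ := ν.exists_greenState_eq_encrypt ψ
  rw [h, brokenState_eq_tensorAlong, h', weight_smul, hc, one_pow, one_mul,
    weight_tensorAlong ν.colouring.greenVertex_injective,
    Finset.prod_eq_one fun w _ => ν.qubitWeight_separated w, mul_one, weight_smul, hc', one_pow,
    one_mul, encrypt, weight_powX, weight_rotZ, weight_entangle, M.start_eq_tensorAlong,
    weight_tensorAlong Subtype.val_injective, Finset.prod_eq_one fun w _ => qubitWeight_plusKet 0,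
    mul_one]

theorem project_trap_entangled (ψ : QState M.input) {t : DTVertex G} (ht : ν.colouring.IsTrap t) :
    project t (ν.θ t) 1 (ν.entangled ψ) = 0 := by
  obtain ⟨c, -, h⟩ := ν.exists_entangled_eq_brokenState ψ
  have hmem := ν.colouring.mem_compl_green.2 ht.colour_ne
  rw [h, brokenState_eq_tensorAlong, project_smul, project_tensorAlong_of_notMem_range,
    separated, if_neg ht.not_isDummy, qubitProject_plusKet]
  · funext z
    rw [Pi.smul_apply, tensorAlong, Finset.prod_eq_zero hmem, mul_zero, smul_zero, Pi.zero_apply]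
    rw [Function.update_self, Pi.zero_apply]
  · rintro l rfl
    exact notMem_compl_image _ l hmem

theorem outcome_trap (ψ : QState M.input) {c : Branch (DTVertex G)} (hc : c ∈ ν.honestRun ψ)
    (h0 : weight c.state ≠ 0) {t : DTVertex G} (ht : ν.colouring.IsTrap t) : c.b t = ν.r t := by
  have hmem : ∀ w, w ∈ ν.outputTraps ↔ ν.colouring.IsTrap w ∧ baseLocation G w ∈ M.output :=
    fun w => by simp [outputTraps]
  have hδ : ∀ s, ν.sentAngle t s = ν.θ t + bitPi (ν.r t) := fun s => if_neg ht.colour_ne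
  refine outcome_eq_of_project_eq_zero hδ (l := ν.order ++ ν.outputTraps) ?_ ?_
    (c := ⟨0, 0, ν.entangled ψ⟩) (ν.project_trap_entangled ψ ht) hc ?_
  · refine List.nodup_append'.2 ⟨ν.order_nodup, Finset.nodup_toList _, fun w h1 h2 => ?_⟩
    exact (ν.mem_order w).1 h1 ((hmem w).1 h2).2
  · rw [List.mem_append, ν.mem_order, hmem]
    tauto
  · rintro h
    exact h0 (by rw [h, weight_zero])

theorem acceptProb_eq_weight (ψ : QState M.input) : ν.acceptProb ψ = weight ψ := by
  rw [acceptProb, sum_map_filter_eq, ← ν.weight_entangled ψ]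
  refine Eq.trans ?_ (sum_weight_branches (δ := ν.sentAngle) (r := ν.r)
    (ν.order ++ ν.outputTraps) ⟨0, 0, ν.entangled ψ⟩)
  refine congrArg List.sum (List.map_congr_left fun c hc => ite_eq_left_iff.2 fun hacc => ?_)
  by_contra h0
  exact hacc fun t ht => ν.outcome_trap ψ hc (Ne.symm h0) ht

/-! ### The honest run simulates the pattern -/

/-- The angle sent for a green qubit undoes its encryption, and the outcome is flipped by `r`. -/
theorem project_encrypt (l : DottedVertex G) (s : DTVertex G → ZMod 2) (β : ZMod 2)
    (Φ : QState (DottedVertex G)) :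
    project l (ν.sentAngle (ν.colouring.greenVertex l) s) β (ν.encrypt Φ) =
      ν.encrypt (project l (M.adapted l (s ∘ ν.colouring.greenVertex))
        (β + ν.r (ν.colouring.greenVertex l)) Φ) := by
  have hangle : ∀ (x ρ : ZMod 2) (a k : ZMod 8),
      bitNeg x (bitNeg x (a + k) + bitPi ρ) - k = a + bitPi ρ := by decide
  rw [encrypt, project_powX, project_rotZ, sentAngle, if_pos (ν.colouring.colour_greenVertex l),
    ν.inputFlip_greenVertex, hangle, project_add_bitPi, ν.colouring.baseLocation_greenVertex,
    encrypt]

/-- Summed over all branches, a quantity that sees the traps and dummies only through their squared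
norm takes the value that it has for the pattern. At a green qubit the branches correspond, up to
an exchange of the two outcomes if `r = 1`; at a trap or dummy the squared norms of the two
outcomes add up. -/
theorem sum_branches_eq {A : Type*} [AddCommMonoid A] [Module ℂ A] (k : ℂ)
    (F : (DTVertex G → ZMod 2) → QState (DTVertex G) → A)
    (F₀ : (DottedVertex G → ZMod 2) → QState (DottedVertex G) → A)
    (hF : ∀ s Φ q, F s (k • tensorAlong ν.colouring.greenVertex (ν.encrypt Φ) q) =
      ((∏ w ∈ (Finset.univ.image ν.colouring.greenVertex)ᶜ, qubitWeight (q w) : ℝ) : ℂ) •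
        F₀ (s ∘ ν.colouring.greenVertex) Φ)
    (l : List (DTVertex G)) (b s : DTVertex G → ZMod 2) (b₀ : DottedVertex G → ZMod 2)
    (Φ : QState (DottedVertex G)) (q : DTVertex G → ZMod 2 → ℂ) :
    ((branches ν.sentAngle ν.r l
        ⟨b, s, k • tensorAlong ν.colouring.greenVertex (ν.encrypt Φ) q⟩).map fun c =>
      F c.s c.state).sum =
    ((∏ w ∈ (Finset.univ.image ν.colouring.greenVertex)ᶜ, qubitWeight (q w) : ℝ) : ℂ) •
      ((branches M.adapted 0
          ((l.filter fun w => ν.colouring.colour w = .green).map (baseLocation G))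
          ⟨b₀, s ∘ ν.colouring.greenVertex, Φ⟩).map fun c => F₀ c.s c.state).sum := by
  have hinj := ν.colouring.greenVertex_injective
  induction l generalizing b s b₀ Φ q with
  | nil => simp [branches, hF]
  | cons w l ih =>
    rw [sum_map_branches_cons]
    by_cases hw : ν.colouring.colour w = .green
    · obtain ⟨i, rfl⟩ : ∃ i, ν.colouring.greenVertex i = w :=
        ⟨_, ν.colouring.greenVertex_baseLocation hw⟩
      rw [List.filter_cons_of_pos (by simpa using hw), List.map_cons,
        ν.colouring.baseLocation_greenVertex, sum_map_branches_cons, Finset.smul_sum]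
      refine Fintype.sum_equiv (Equiv.addRight (ν.r (ν.colouring.greenVertex i))) _ _ fun β => ?_
      rw [measureStep, measureStep, project_smul, project_tensorAlong hinj, ν.project_encrypt,
        ih _ _ (Function.update b₀ i (β + ν.r (ν.colouring.greenVertex i))),
        Function.update_comp_eq_of_injective _ hinj, Equiv.coe_addRight, Pi.zero_apply, add_zero]
    · have hne : ∀ i, ν.colouring.greenVertex i ≠ w := by
        rintro i rfl
        exact hw (ν.colouring.colour_greenVertex i)
      have hmem := ν.colouring.mem_compl_green.2 hw
      have hs : ∀ β, Function.update s w β ∘ ν.colouring.greenVertex =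
          s ∘ ν.colouring.greenVertex := fun β =>
        Function.update_comp_eq_of_forall_ne _ _ hne
      rw [List.filter_cons_of_neg (by simpa using hw)]
      simp only [measureStep, project_smul, project_tensorAlong_of_notMem_range hne, ih _ _ b₀, hs]
      rw [← Finset.sum_smul, sum_zmod_two, ← Complex.ofReal_add]
      congr 2
      have herase : ∀ q', ∏ v ∈ (Finset.univ.image ν.colouring.greenVertex)ᶜ,
          qubitWeight (Function.update q w q' v) = qubitWeight q' *
            ∏ v ∈ (Finset.univ.image ν.colouring.greenVertex)ᶜ.erase w, qubitWeight (q v) := by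
        intro q'
        rw [← Finset.mul_prod_erase _ _ hmem, Function.update_self]
        exact congrArg _ (Finset.prod_congr rfl fun v hv => by
          rw [Function.update_of_ne (Finset.ne_of_mem_erase hv)])
      rw [herase, herase, ← add_mul, qubitWeight_qubitProject,
        Finset.mul_prod_erase _ (fun v => qubitWeight (q v)) hmem]

/-- The derived Boolean equality on a sum type, by which `List.idxOf` looks up a vertex of `D(G)`, is
equality. -/
instance {A B : Type*} [BEq A] [BEq B] [LawfulBEq A] [LawfulBEq B] : LawfulBEq (A ⊕ B) where
  rfl {a} := by
    rcases a with a | b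
    · exact (beq_self_eq_true a)
    · exact (beq_self_eq_true b)
  eq_of_beq {a b} h := by
    rcases a with a | a <;> rcases b with b | b
    · exact congrArg Sum.inl (eq_of_beq (show (a == b) = true from h))
    · cases h
    · cases h
    · exact congrArg Sum.inr (eq_of_beq (show (a == b) = true from h))

/-- The green vertices are measured in the order of the pattern. -/
theorem map_filter_order :
    ((ν.order ++ ν.outputTraps).filter fun w => ν.colouring.colour w = .green).map
      (baseLocation G) = M.order := by
  have htraps : (ν.outputTraps.filter fun w => ν.colouring.colour w = .green) = [] := by
    rw [List.filter_eq_nil_iff]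
    intro w hw
    have ht : ν.colouring.IsTrap w := by
      simp only [outputTraps, Finset.mem_toList, Finset.mem_filter] at hw
      exact hw.2.1
    simpa using ht.colour_ne
  rw [List.filter_append, htraps, List.append_nil]
  set l := (ν.order.filter fun w => ν.colouring.colour w = .green).map (baseLocation G) with hl
  have hmem : ∀ i, i ∈ l ↔ i ∈ M.order := by
    intro i
    rw [M.mem_order, hl, List.mem_map]
    constructor
    · rintro ⟨w, hw, rfl⟩
      exact (ν.mem_order w).1 (List.mem_filter.1 hw).1
    · intro hi
      refine ⟨ν.colouring.greenVertex i, List.mem_filter.2 ⟨(ν.mem_order _).2 ?_, ?_⟩, ?_⟩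
      · rwa [ν.colouring.baseLocation_greenVertex]
      · simpa using ν.colouring.colour_greenVertex i
      · exact ν.colouring.baseLocation_greenVertex i
  have hnodup : l.Nodup := by
    refine List.Nodup.map_on (fun w hw w' hw' h => ?_) (ν.order_nodup.filter _)
    have h1 := (List.mem_filter.1 hw).2
    have h2 := (List.mem_filter.1 hw').2
    rw [← ν.colouring.greenVertex_baseLocation (w := w) (by simpa using h1), h,
      ν.colouring.greenVertex_baseLocation (by simpa using h2)]
  have hsorted : M.order.Pairwise fun i j => M.order.idxOf i ≤ M.order.idxOf j := by
    rw [List.pairwise_iff_getElem]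
    intro i j hi hj hij
    rw [M.order_nodup.idxOf_getElem, M.order_nodup.idxOf_getElem]
    exact hij.le
  refine List.Perm.eq_of_pairwise (le := fun i j => M.order.idxOf i ≤ M.order.idxOf j) ?_ ?_
    hsorted ((List.perm_ext_iff_of_nodup hnodup M.order_nodup).2 hmem)
  · intro i j hi _ h1 h2
    exact (List.idxOf_inj ((hmem i).1 hi)).1 (le_antisymm h1 h2)
  · exact List.pairwise_map.2 (ν.order_base.filter _)

/-- Decoding removes the encryption of the output qubits; that of the other qubits does not affect
the reduced state. -/
theorem reduced_decode (s : DTVertex G → ZMod 2) (k : ℂ) (hk : ‖k‖ = 1)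
    (Φ : QState (DottedVertex G)) (q : DTVertex G → ZMod 2 → ℂ) :
    reduced (fun o : M.output => ν.colouring.greenVertex o)
        (ν.decode s (k • tensorAlong ν.colouring.greenVertex (ν.encrypt Φ) q)) =
      ((∏ w ∈ (Finset.univ.image ν.colouring.greenVertex)ᶜ, qubitWeight (q w) : ℝ) : ℂ) •
        reduced (fun o : M.output => (o : DottedVertex G))
          (M.correct (s ∘ ν.colouring.greenVertex) Φ) := by
  have hinj := ν.colouring.greenVertex_injective
  have hoff : ∀ w ∈ (Finset.univ.image ν.colouring.greenVertex)ᶜ, ¬ ν.IsOutput w :=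
    fun w hw h => ν.colouring.mem_compl_green.1 hw h.1
  have hout : ∀ {B : Type} [Zero B] (h : DTVertex G → B),
      (fun w => if ν.IsOutput w then h w else 0) ∘ ν.colouring.greenVertex =
        fun l => if l ∈ M.output then h (ν.colouring.greenVertex l) else 0 := fun h =>
    funext fun l => if_congr (ν.isOutput_greenVertex l) rfl rfl
  have hpow : ∀ (x : DTVertex G → ZMod 2) (c : ℂ) Ψ, powX x (c • Ψ) = c • powX x Ψ :=
    fun _ _ _ => rfl
  let x' : DottedVertex G → ZMod 2 := fun l => if l ∈ M.output then 0 else ν.flip l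
  let θ' : DottedVertex G → ZMod 8 := fun l =>
    if l ∈ M.output then 0 else ν.key (ν.colouring.greenVertex l)
  -- The part of the encryption on the output qubits cancels, and what is left commutes with the
  -- corrections, which act on the output qubits only.
  have hdec : ν.decode s (k • tensorAlong ν.colouring.greenVertex (ν.encrypt Φ) q) =
      k • tensorAlong ν.colouring.greenVertex
        (powX x' (rotZ θ' (M.correct (s ∘ ν.colouring.greenVertex) Φ))) q := by
    have hx : (fun l => if l ∈ M.output then ν.flip l else 0) + ν.flip = x' := by
      funext l
      by_cases hl : l ∈ M.output
      · simp [x', hl, CharTwo.add_self_eq_zero]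
      · simp [x', hl]
    have hθ : (fun l => if l ∈ M.output then -ν.key (ν.colouring.greenVertex l) else 0) +
        (fun l => ν.key (ν.colouring.greenVertex l)) = θ' := by
      funext l
      by_cases hl : l ∈ M.output <;> simp [θ', hl]
    rw [decode]
    simp only [hpow, rotZ_smul]
    rw [powX_tensorAlong_of_support fun w hw => if_neg (hoff w hw),
      rotZ_tensorAlong_of_support hinj fun w hw => if_neg (hoff w hw),
      powX_tensorAlong_of_support fun w hw => if_neg (hoff w hw),
      rotZ_tensorAlong_of_support hinj fun w hw => if_neg (hoff w hw), hout, hout, hout, hout]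
    simp only [ν.inputFlip_greenVertex, ν.colouring.baseLocation_greenVertex]
    have hsep : ∀ {B C : Type} [Zero B] [Zero C] (h : DottedVertex G → B) (h' : DottedVertex G → C)
        l, (if l ∈ M.output then h l else 0) = 0 ∨ (if l ∈ M.output then 0 else h' l) = 0 := by
      intro B C _ _ h h' l
      by_cases hl : l ∈ M.output
      · exact .inr (if_pos hl)
      · exact .inl (if_neg hl)
    have hsepx : ∀ h : DottedVertex G → ZMod 8, ∀ l,
        (if l ∈ M.output then h l else 0) = 0 ∨ x' l = 0 := fun h => hsep h ν.flip
    have hsepθ : ∀ h : DottedVertex G → ZMod 2, ∀ l,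
        θ' l = 0 ∨ (if l ∈ M.output then h l else 0) = 0 := fun h l =>
      (hsep h (fun l => ν.key (ν.colouring.greenVertex l)) l).symm
    rw [encrypt, powX_powX, hx, rotZ_powX (hsepx _), rotZ_rotZ, hθ, powX_powX,
      add_comm _ x', ← powX_powX, ← rotZ_powX (hsepθ _), rotZ_powX (hsepx _),
      rotZ_rotZ, add_comm _ θ', ← rotZ_rotZ]
    rfl
  rw [hdec, reduced_smul, hk, one_pow, Complex.ofReal_one, one_smul]
  refine (reduced_tensorAlong hinj (fun o : M.output => (o : DottedVertex G)) _ q).trans ?_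
  have hx' : ∀ o : M.output, x' o = 0 := fun o => if_pos o.2
  have hθ' : ∀ o : M.output, θ' o = 0 := fun o => if_pos o.2
  rw [reduced_powX _ hx', reduced_rotZ _ hθ']

theorem result_eq [DecidableEq α] (ψ : QState M.input) (a : α) :
    ν.result ψ a = M.result (dotted G) ψ a := by
  obtain ⟨c, hc, h⟩ := ν.exists_entangled_eq_brokenState ψ
  obtain ⟨c', hc', h'⟩ := ν.exists_greenState_eq_encrypt ψ
  have hstate : ν.entangled ψ = (c * c') • tensorAlong ν.colouring.greenVertex
      (ν.encrypt (entangle (dotted G) (M.start ψ))) ν.separated := by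
    rw [h, brokenState_eq_tensorAlong, h', mul_smul]
    congr 1
    funext z
    exact mul_assoc _ _ _
  have hsum := ν.sum_branches_eq (c * c')
    (fun s Ψ => if M.readout (s ∘ ν.colouring.greenVertex) = a then
      reduced (fun o : M.output => ν.colouring.greenVertex o) (ν.decode s Ψ) else 0)
    (fun s Φ => if M.readout s = a then
      reduced (fun o : M.output => (o : DottedVertex G)) (M.correct s Φ) else 0)
    (fun s Φ q => by
      rw [ν.reduced_decode s _ (by rw [norm_mul, hc, hc', mul_one]), smul_ite, smul_zero])
    (ν.order ++ ν.outputTraps) 0 0 0 (entangle (dotted G) (M.start ψ)) ν.separated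
  rw [ν.map_filter_order, Finset.prod_eq_one fun w _ => ν.qubitWeight_separated w,
    Complex.ofReal_one, one_smul, ← hstate] at hsum
  rw [result, MeasurementPattern.result, sum_map_filter_eq, sum_map_filter_eq]
  exact hsum

end Secrets

end Protocol

/-! ### Correctness of the protocol -/

theorem mainTheorem6 {V : Type*} [Fintype V] [DecidableEq V] (G : SimpleGraph V)
    [DecidableRel G.Adj] {α : Type*} [DecidableEq α]
    -- the measurement pattern on the dotted base graph, which performs the computation `E`
    (M : MeasurementPattern (DottedVertex G) α)
    (E : α → Matrix (M.input → ZMod 2) (M.input → ZMod 2) ℂ →ₗ[ℂ]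
      Matrix (M.output → ZMod 2) (M.output → ZMod 2) ℂ)
    (hE : M.Performs (dotted G) E)
    -- any choice of the verifier's secrets, and any input state
    (ν : Secrets M) (ψ : QState M.input) (hψ : weight ψ = 1) :
    -- the green vertices induce a copy of `D(G)`, with the obvious base-locations
    (∃ f : dotted G ≃g (dottedTriple G).induce {w | ν.colouring.colour w = .green},
      ∀ l, (f l : DTVertex G) = ν.colouring.greenVertex l ∧ baseLocation G (f l) = l) ∧
    -- every vertex is green, a trap or a dummy, in an exclusive way
    (∀ w, (ν.colouring.colour w = .green ∧ ¬ ν.colouring.IsTrap w ∧ ¬ ν.colouring.IsDummy w) ∨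
      (ν.colouring.colour w ≠ .green ∧ ν.colouring.IsTrap w ∧ ¬ ν.colouring.IsDummy w) ∨
      (ν.colouring.colour w ≠ .green ∧ ¬ ν.colouring.IsTrap w ∧ ν.colouring.IsDummy w)) ∧
    -- there is one trap at each base-location, and without the dummies the traps are isolated
    (∀ l, ∃! t, baseLocation G t = l ∧ ν.colouring.IsTrap t) ∧
    (∀ t w, ν.colouring.IsTrap t → ¬ ν.colouring.IsDummy w → ¬ (dottedTriple G).Adj t w) ∧
    -- up to a global phase, the prover's entangled state is the product of the pre-rotated
    -- green graph state, the isolated traps and the dummies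
    (∃ c : ℂ, ‖c‖ = 1 ∧ ν.entangled ψ = c • ν.brokenState ψ) ∧
    -- all traps return `b = r`, in every branch of non-zero probability
    (∀ c ∈ ν.honestRun ψ, weight c.state ≠ 0 → ∀ t, ν.colouring.IsTrap t → c.b t = ν.r t) ∧
    -- the verifier accepts with certainty
    ν.acceptProb ψ = 1 ∧
    -- the result is that of the computation
    (∀ a, ν.result ψ a = E a (ketBra ψ)) :=
  ⟨⟨ν.colouring.greenIso, fun l => ⟨rfl, ν.colouring.baseLocation_greenVertex l⟩⟩,
    ν.colouring.green_or_trap_or_dummy, ν.colouring.existsUnique_trap,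
    fun _ _ => ν.colouring.not_adj_of_isTrap, ν.exists_entangled_eq_brokenState ψ,
    fun _ hc h0 _ ht => ν.outcome_trap ψ hc h0 ht, (ν.acceptProb_eq_weight ψ).trans hψ,
    fun a => (ν.result_eq ψ a).trans (hE ψ hψ a)⟩
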